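/- Let $(X,\omega)$ be a compact Hermitian manifold of dimension $n\ge 1$ (connectedness is not assumed), let $\Sigma\subset X$ be a smooth analytic hypersurface, and let $\omega^n/n!$ be the volume form of $\omega$. For a real number $t>0$ and a holomorphic line bundle $L$ on $X$ with a singular Hermitian metric $h$ with locally bounded weights (no positivity is assumed), write $h_p=h^{\otimes p}$ and let $$H^0_0(X,L^p)=H^0\big(X,L^p\otimes\mathcal O(-\lfloor tp\rfloor\Sigma)\big)$$ be the space of holomorphic sections of $L^p=L^{\otimes p}$ vanishing to order at least $\lfloor tp\rfloor$ along $\Sigma$, with the inner product $(S,S')_p=\int_X\langle S,S'\rangle_{h_p}\,\omega^n/n!$ and the norm $\|S\|_p^2=(S,S)_p$. This space is finite dimensional and has orthonormal bases; the partial Bergman kernel function $P_{0,p}(x)=\sum_j|S_j(x)|^2_{h_p}$, where $(S_j)$ is an orthonormal basis of $H^0_0(X,L^p)$, does not depend on the choice of the basis. For functions $f_p$ $(p\ge1)$ on a set $M\subset X$, $f_p=O(p^{-\infty})$ on $M$ means: for every compact $K\subset M$ and $\ell\in\mathbb N$ there is $C>0$ with $\sup_K|f_p|\le C\,p^{-\ell}$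 for all $p\ge1$. (1) For all such $t,L,h$ there exist an open neighborhood $U$ of $\Sigma$ and a constant $a\in(0,1)$ such that $P_{0,p}\le a^p$ on $U$ for all integers $p>2/t$, and $P_{0,p}=O(p^{-\infty})$ on $U$. (2) Let $S_\Sigma$ be a canonical section of $\mathcal O(\Sigma)$ (a holomorphic section vanishing exactly on $\Sigma$, to first order), and let $h_\Sigma$ be a smooth Hermitian metric on $\mathcal O(\Sigma)$ such that $\rho:=\log|S_\Sigma|_{h_\Sigma}<0$ on $X$. Let $\mathcal W=\{W_j\}_{1\le j\le N}$ be a finite family of holomorphic coordinate neighborhoods $(W_j,z)$, centered at points $y_j\in\Sigma$, such that the closed polydisks $\Delta(y_j,r)=\{\max_i|z_i|\le r\}$ satisfy $$\Delta(y_j,2)\subset W_j,\qquad \Sigma\cap W_j=\{z_1=0\},\qquad \Sigma\subset W:=\bigcup_j\Delta(y_j,1).$$ Then there is a constant $A\ge1$, depending only on $(X,\omega)$, $\Sigma$, $\rho$ and $\mathcal W$, such that the following holds for all $t>0$, all $(L,h)$ as above and all holomorphic frames $e_j$ of $L$ on $W_j$. Define $\varphi_j$ by $|e_j|_h=e^{-\varphi_j}$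 and put $\|h\|_\infty=\max\{1,\sup_{\Delta(y_j,2)}|\varphi_j|:1\le j\le N\}$. * For all integers $p\ge1$ with $tp\ge1$, all $S\in H^0_0(X,L^p)$ and $x\in W$, $$|S(x)|^2_{h_p}\le(Ae^{\rho(x)})^{2\lfloor tp\rfloor}e^{4p\|h\|_\infty}\|S\|_p^2,\qquad P_{0,p}(x)\le(Ae^{\rho(x)})^{2\lfloor tp\rfloor}e^{4p\|h\|_\infty}.$$ * For all integers $p\ge1$ with $tp<1$, all $S\in H^0_0(X,L^p)$ and $x\in W$, $$|S(x)|^2_{h_p}\le A\,e^{4p\|h\|_\infty}\|S\|_p^2,\qquad P_{0,p}(x)\le A\,e^{4p\|h\|_\infty}.$$ * Let $U_t=\{x\in W:(Ae^{\rho(x)})^te^{4\|h\|_\infty}<1\}$. For all integers $p>2/t$ and all $x\in U_t$, $$P_{0,p}(x)\le\big[(Ae^{\rho(x)})^te^{4\|h\|_\infty}\big]^p,$$ and $P_{0,p}=O(p^{-\infty})$ on $U_t$. If $W$ is a neighborhood of $\Sigma$, then so is $U_t$. -/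

import Mathlib

open scoped Manifold ContDiff Topology TensorProduct ComplexConjugate

noncomputable section

/-! Complex manifolds of dimension `n` are modelled on `Fin n → ℂ` (sup norm, so that closed balls
are closed polydisks), with holomorphic (= complex analytic, `ω`) transition maps.  Holomorphic
line bundles are Mathlib vector bundles with fibre `ℂ` and holomorphic transition functions. -/

section Manifold

variable {n : ℕ} {X : Type*} [TopologicalSpace X] [ChartedSpace (Fin n → ℂ) X]

/-- `f` is a holomorphic function on `V`. -/
def IsHolomorphicOn (n : ℕ) {X : Type*} [TopologicalSpace X] [ChartedSpace (Fin n → ℂ) X]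
    (f : X → ℂ) (V : Set X) : Prop :=
  ContMDiffOn 𝓘(ℂ, Fin n → ℂ) 𝓘(ℂ, ℂ) ω f V

/-- `f` is a holomorphic function on `V`, whose zero set in `V` is `Y ∩ V`, and whose differential
does not vanish at the points of `Y ∩ V`: a generator of the ideal sheaf of `Y` on `V`. -/
structure IsDefiningFunctionOn (n : ℕ) {X : Type*} [TopologicalSpace X]
    [ChartedSpace (Fin n → ℂ) X] (Y V : Set X) (f : X → ℂ) : Prop where
  holomorphic : IsHolomorphicOn n f V
  zero_iff : ∀ x ∈ V, f x = 0 ↔ x ∈ Y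
  mfderiv_ne_zero : ∀ x ∈ V, x ∈ Y → mfderiv 𝓘(ℂ, Fin n → ℂ) 𝓘(ℂ, ℂ) f x ≠ 0

/-- A smooth analytic hypersurface. -/
structure IsSmoothHypersurface (n : ℕ) {X : Type*} [TopologicalSpace X]
    [ChartedSpace (Fin n → ℂ) X] (Y : Set X) : Prop where
  isClosed : IsClosed Y
  exists_definingFunction : ∀ x ∈ Y, ∃ V : Set X, IsOpen V ∧ x ∈ V ∧
    ∃ f : X → ℂ, IsDefiningFunctionOn n Y V f

/-- The coordinate vector field `∂/∂z_j` of the chart `φ`, at the point with coordinates `z`. -/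
def coordVector (φ : OpenPartialHomeomorph X (Fin n → ℂ)) (z : Fin n → ℂ) (j : Fin n) :
    TangentSpace 𝓘(ℂ, Fin n → ℂ) (φ.symm z) :=
  mfderiv 𝓘(ℂ, Fin n → ℂ) 𝓘(ℂ, Fin n → ℂ) φ.symm z
    (show Fin n → ℂ from Pi.single j 1)

/-- A smooth Hermitian metric on the complex manifold `X`: smoothly varying Hermitian inner
products `⟨u, v⟩_x` on the holomorphic tangent spaces.  It corresponds to the positive `(1,1)`-form
which is `(i/2) ∑ g_{jk} dz_j ∧ d\bar z_k` in local coordinates, where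
`g_{jk} = ⟨∂_k, ∂_j⟩` (`inner u v` below is antilinear in `u` and linear in `v`). -/
structure HermitianMetric (n : ℕ) (X : Type*) [TopologicalSpace X]
    [ChartedSpace (Fin n → ℂ) X] where
  inner : ∀ x : X, TangentSpace 𝓘(ℂ, Fin n → ℂ) x →ₗ⋆[ℂ]
    TangentSpace 𝓘(ℂ, Fin n → ℂ) x →ₗ[ℂ] ℂ
  conj_symm : ∀ x u v, conj (inner x u v) = inner x v u
  pos : ∀ x u, u ≠ 0 → 0 < (inner x u u).re
  smooth : ∀ φ ∈ IsManifold.maximalAtlas 𝓘(ℂ, Fin n → ℂ) ω X, ∀ j k : Fin n,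
    ContDiffOn ℝ ∞ (fun z => inner (φ.symm z) (coordVector φ z j) (coordVector φ z k)) φ.target

/-- The matrix (entry `(j, k)` is `⟨∂_j, ∂_k⟩`) of the metric in the coordinates given by `φ`. -/
def HermitianMetric.gram (g : HermitianMetric n X) (φ : OpenPartialHomeomorph X (Fin n → ℂ))
    (z : Fin n → ℂ) : Matrix (Fin n) (Fin n) ℂ :=
  Matrix.of fun j k => g.inner (φ.symm z) (coordVector φ z j) (coordVector φ z k)

/-- The measure which the volume form `ω^n / n! = det (g_{jk}) dm(z)` of the metric
(`dm` = Lebesgue measure) induces on the domain of the chart `φ`, as a measure on `X`. -/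
def HermitianMetric.chartVolume [MeasurableSpace X] (g : HermitianMetric n X)
    (φ : OpenPartialHomeomorph X (Fin n → ℂ)) : MeasureTheory.Measure X :=
  ((MeasureTheory.volume.restrict φ.target).withDensity
    fun z => ENNReal.ofReal (g.gram φ z).det.re).map φ.symm

/-- The measure on `X` given by the volume form `ω^n / n!`.  The measures `g.chartVolume φ` agree on
the overlaps of the charts; their supremum in the lattice of measures is the measure on `X`
obtained by gluing them. -/
def HermitianMetric.vol [MeasurableSpace X] (g : HermitianMetric n X) :
    MeasureTheory.Measure X :=
  ⨆ φ ∈ IsManifold.maximalAtlas 𝓘(ℂ, Fin n → ℂ) ω X, g.chartVolume φ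

/-- Finitely many holomorphic coordinate neighbourhoods `W_j` (the sources of the charts `z`), with
`Δ(y_j, 2) ⊆ W_j` where `y_j` is the point with coordinates `0`, with `Y ∩ W_j = {z_1 = 0}`, and such
that the closed unit polydisks `Δ(y_j, 1)` cover `Y`.  (The first coordinate has index `0`.) -/
structure AdaptedCover (n : ℕ) [NeZero n] {X : Type*} [TopologicalSpace X]
    [ChartedSpace (Fin n → ℂ) X] (Y : Set X) where
  N : ℕ
  chart : Fin N → OpenPartialHomeomorph X (Fin n → ℂ)
  chart_mem : ∀ j, chart j ∈ IsManifold.maximalAtlas 𝓘(ℂ, Fin n → ℂ) ω X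
  polydisk_subset : ∀ j, Metric.closedBall (0 : Fin n → ℂ) 2 ⊆ (chart j).target
  mem_iff : ∀ j, ∀ x ∈ (chart j).source, x ∈ Y ↔ chart j x 0 = 0
  covers : Y ⊆ ⋃ j, (chart j).symm '' Metric.closedBall (0 : Fin n → ℂ) 1

/-- The closed polydisk `Δ(y_j, r)`. -/
def AdaptedCover.polydisk [NeZero n] {Y : Set X} (𝒲 : AdaptedCover n Y) (j : Fin 𝒲.N) (r : ℝ) :
    Set X :=
  (𝒲.chart j).symm '' Metric.closedBall (0 : Fin n → ℂ) r

/-- The set `W = ⋃ Δ(y_j, 1)`. -/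
def AdaptedCover.W [NeZero n] {Y : Set X} (𝒲 : AdaptedCover n Y) : Set X :=
  ⋃ j, 𝒲.polydisk j 1

/-- `f_p = O(p^{-∞})` on `M`: for every compact `K ⊆ M` and every `ℓ` there is `C > 0` with
`|f_p| ≤ C p^{-ℓ}` on `K`, for all `p ≥ 1`. -/
def IsBigOInfty (f : ℕ → X → ℝ) (M : Set X) : Prop :=
  ∀ K ⊆ M, IsCompact K → ∀ l : ℕ, ∃ C : ℝ, 0 < C ∧
    ∀ p : ℕ, 1 ≤ p → ∀ x ∈ K, |f p x| ≤ C * ((p : ℝ) ^ l)⁻¹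

end Manifold

section LineBundle

variable {n : ℕ} {X : Type*} [TopologicalSpace X] [ChartedSpace (Fin n → ℂ) X]
  (L : X → Type*) [TopologicalSpace (Bundle.TotalSpace ℂ L)] [∀ x, AddCommGroup (L x)]
  [∀ x, Module ℂ (L x)] [∀ x, TopologicalSpace (L x)] [FiberBundle ℂ L] [VectorBundle ℂ ℂ L]

/-- `e` is a holomorphic frame of the line bundle `L` on `V`: a holomorphic section without zeros
on `V` (the values of `e` outside `V` are irrelevant). -/
structure IsFrameOn (n : ℕ) {X : Type*} [TopologicalSpace X] [ChartedSpace (Fin n → ℂ) X]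
    (L : X → Type*) [TopologicalSpace (Bundle.TotalSpace ℂ L)] [∀ x, AddCommGroup (L x)]
    [∀ x, Module ℂ (L x)] [∀ x, TopologicalSpace (L x)] [FiberBundle ℂ L] [VectorBundle ℂ ℂ L]
    (V : Set X) (e : ∀ x, L x) : Prop where
  holomorphic : ContMDiffOn 𝓘(ℂ, Fin n → ℂ) (𝓘(ℂ, Fin n → ℂ).prod 𝓘(ℂ, ℂ)) ω
    (fun x => (⟨x, e x⟩ : Bundle.TotalSpace ℂ L)) V
  ne_zero : ∀ x ∈ V, e x ≠ 0

/-- A Hermitian metric on the line bundle `L`, given by the norms `|v|_h` on the fibres, without any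
regularity in the base point.  (On a complex line, a Hermitian inner product is the same as a
norm.) -/
structure LineMetric {X : Type*} (L : X → Type*) [∀ x, AddCommGroup (L x)]
    [∀ x, Module ℂ (L x)] where
  norm : ∀ x, L x → ℝ
  norm_smul : ∀ x (c : ℂ) (v : L x), norm x (c • v) = ‖c‖ * norm x v
  norm_pos : ∀ x (v : L x), v ≠ 0 → 0 < norm x v

variable {L}

/-- The weight `φ` of `h` with respect to the frame `e`: `|e|_h = exp (-φ)`. -/
def LineMetric.weight (h : LineMetric L) (e : ∀ x, L x) (x : X) : ℝ :=
  -Real.log (h.norm x (e x))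

/-- `h` is a singular Hermitian metric with locally bounded weights: on open sets, the weights with
respect to holomorphic frames are locally bounded and Lebesgue measurable (in charts), hence in
particular locally integrable. -/
structure LineMetric.HasLocallyBoundedWeights (n : ℕ) [ChartedSpace (Fin n → ℂ) X]
    (h : LineMetric L) : Prop where
  locallyBounded : ∀ V : Set X, IsOpen V → ∀ e : (∀ x, L x), IsFrameOn n L V e →
    ∀ x ∈ V, ∃ C : ℝ, ∀ᶠ y in 𝓝 x, |h.weight e y| ≤ C
  aemeasurable : ∀ V : Set X, IsOpen V → ∀ e : (∀ x, L x), IsFrameOn n L V e →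
    ∀ φ ∈ IsManifold.maximalAtlas 𝓘(ℂ, Fin n → ℂ) ω X,
      AEMeasurable (fun z => h.weight e (φ.symm z))
        (MeasureTheory.volume.restrict (φ.target ∩ φ.symm ⁻¹' V))

/-- `h` is a smooth Hermitian metric: its weights are (real) smooth functions. -/
def LineMetric.IsSmooth (n : ℕ) [ChartedSpace (Fin n → ℂ) X] (h : LineMetric L) : Prop :=
  ∀ V : Set X, IsOpen V → ∀ e : (∀ x, L x), IsFrameOn n L V e →
    ContMDiffOn 𝓘(ℝ, Fin n → ℂ) 𝓘(ℝ, ℝ) ∞ (h.weight e) V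

/-- `s` is a holomorphic section of the line bundle `L` which vanishes exactly on `Y`, to first
order.  So the divisor of `s` is `Y`, i.e. `(L, s)` is the line bundle `𝒪(Y)` with its canonical
section. -/
def IsCanonicalSection (n : ℕ) [ChartedSpace (Fin n → ℂ) X] (Y : Set X) (s : ∀ x, L x) : Prop :=
  ∀ V : Set X, IsOpen V → ∀ e : (∀ x, L x), IsFrameOn n L V e →
    ∃ f : X → ℂ, IsDefiningFunctionOn n Y V f ∧ ∀ x ∈ V, s x = f x • e x

variable (L)

/-- The element `v^{⊗p}` of `L_x^{⊗p}`. -/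
abbrev tpow (p : ℕ) {x : X} (v : L x) : ⨂[ℂ]^p (L x) :=
  PiTensorProduct.tprod ℂ fun _ => v

/-- The space `H^0(X, L^p ⊗ 𝒪(-kY))` of the holomorphic sections of `L^p` vanishing to order at
least `k` along `Y`: on open sets, these are `s e^{⊗p}` with holomorphic `s` when `e` is a
holomorphic frame of `L`, and `s` is divisible by `f^k` when moreover the ideal sheaf of `Y` is
generated by `f`. -/
def sectionsVanishing (n : ℕ) [ChartedSpace (Fin n → ℂ) X] (Y : Set X) (k p : ℕ) :
    Submodule ℂ (∀ x, ⨂[ℂ]^p (L x)) where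
  carrier := {S |
    (∀ V : Set X, IsOpen V → ∀ e : (∀ x, L x), IsFrameOn n L V e →
      ∃ s : X → ℂ, IsHolomorphicOn n s V ∧ ∀ x ∈ V, S x = s x • tpow L p (e x)) ∧
    (∀ V : Set X, IsOpen V → ∀ e : (∀ x, L x), IsFrameOn n L V e →
      ∀ f : X → ℂ, IsDefiningFunctionOn n Y V f →
      ∃ s : X → ℂ, IsHolomorphicOn n s V ∧ ∀ x ∈ V, S x = (f x ^ k * s x) • tpow L p (e x))}
  zero_mem' := by
    refine ⟨fun V _ e _ => ⟨fun _ => 0, contMDiffOn_const, fun x _ => ?_⟩,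
      fun V _ e _ f _ => ⟨fun _ => 0, contMDiffOn_const, fun x _ => ?_⟩⟩ <;> simp
  add_mem' := by
    rintro S T ⟨hS, hS'⟩ ⟨hT, hT'⟩
    refine ⟨fun V hV e he => ?_, fun V hV e he f hf => ?_⟩
    · obtain ⟨s, hs, hs'⟩ := hS V hV e he
      obtain ⟨u, hu, hu'⟩ := hT V hV e he
      refine ⟨s + u, ContMDiffOn.add hs hu, fun x hx => ?_⟩
      simp [hs' x hx, hu' x hx, add_smul]
    · obtain ⟨s, hs, hs'⟩ := hS' V hV e he f hf
      obtain ⟨u, hu, hu'⟩ := hT' V hV e he f hf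
      refine ⟨s + u, ContMDiffOn.add hs hu, fun x hx => ?_⟩
      simp [hs' x hx, hu' x hx, mul_add, add_smul]
  smul_mem' := by
    rintro c S ⟨hS, hS'⟩
    refine ⟨fun V hV e he => ?_, fun V hV e he f hf => ?_⟩
    · obtain ⟨s, hs, hs'⟩ := hS V hV e he
      refine ⟨fun x => c * s x, contMDiffOn_const.mul hs, fun x hx => ?_⟩
      simp [hs' x hx, smul_smul]
    · obtain ⟨s, hs, hs'⟩ := hS' V hV e he f hf
      refine ⟨fun x => c * s x, contMDiffOn_const.mul hs, fun x hx => ?_⟩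
      simp [hs' x hx, smul_smul, mul_left_comm]

/-- A linear coordinate on the complex line `L_x`, taken from a local trivialization. -/
def fibreCoord (x : X) : L x →ₗ[ℂ] ℂ :=
  (trivializationAt ℂ L x).linearMapAt ℂ x

/-- The vector of `L_x` with coordinate `1`. -/
def fibreVector (x : X) : L x :=
  (trivializationAt ℂ L x).symmₗ ℂ x 1

/-- The induced linear coordinate on `L_x^{⊗p}`, sending `u_1 ⊗ ⋯ ⊗ u_p` to the product of the
coordinates of the `u_i`. -/
def tensorCoord (p : ℕ) (x : X) : ⨂[ℂ]^p (L x) →ₗ[ℂ] ℂ :=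
  PiTensorProduct.lift
    ((MultilinearMap.mkPiAlgebra ℂ (Fin p) ℂ).compLinearMap fun _ => fibreCoord L x)

variable {L}

/-- The Hermitian inner product `⟨T, T'⟩_{h_p}` on `L_x^{⊗p}` induced by `h`, where
`h_p = h^{⊗p}`; it is linear in `T`, antilinear in `T'`.  It is given by
`⟨a v^{⊗p}, b v^{⊗p}⟩ = a \bar b |v|_h^{2p}`, see `tensorInner_smul_tpow`. -/
def LineMetric.tensorInner (h : LineMetric L) (p : ℕ) (x : X) (T T' : ⨂[ℂ]^p (L x)) : ℂ :=
  tensorCoord L p x T * conj (tensorCoord L p x T') *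
    ((h.norm x (fibreVector L x) ^ (2 * p) : ℝ) : ℂ)

theorem LineMetric.tensorInner_smul_tpow (h : LineMetric L) (p : ℕ) (x : X) (a b : ℂ) (v : L x) :
    h.tensorInner p x (a • tpow L p v) (b • tpow L p v) =
      a * conj b * ((h.norm x v ^ (2 * p) : ℝ) : ℂ) := by
  have hx : x ∈ (trivializationAt ℂ L x).baseSet := FiberBundle.mem_baseSet_trivializationAt' x
  have hv : v = fibreCoord L x v • fibreVector L x := by
    have h1 : fibreVector L x = (trivializationAt ℂ L x).symmₗ ℂ x 1 := rfl
    rw [h1, ← map_smul, smul_eq_mul, mul_one]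
    exact ((trivializationAt ℂ L x).symmₗ_linearMapAt hx v).symm
  have hn : h.norm x v = ‖fibreCoord L x v‖ * h.norm x (fibreVector L x) := by
    conv_lhs => rw [hv]
    exact h.norm_smul x _ _
  have ht : tensorCoord L p x (tpow L p v) = fibreCoord L x v ^ p := by
    simp [tensorCoord, tpow]
  simp only [LineMetric.tensorInner, map_smul, ht, hn, smul_eq_mul, map_mul, map_pow]
  have h2 : ((‖fibreCoord L x v‖ : ℝ) : ℂ) ^ 2 = fibreCoord L x v * conj (fibreCoord L x v) := by
    rw [Complex.mul_conj, Complex.normSq_eq_norm_sq]; push_cast; ring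
  push_cast
  rw [mul_pow, pow_mul ((‖fibreCoord L x v‖ : ℝ) : ℂ) 2 p, h2, mul_pow]
  ring

/-- `|T|_{h_p}^2 = ⟨T, T⟩_{h_p}`. -/
def LineMetric.tensorNormSq (h : LineMetric L) (p : ℕ) (x : X) (T : ⨂[ℂ]^p (L x)) : ℝ :=
  (h.tensorInner p x T T).re

/-- The `L^2` inner product `(S, S')_p = ∫_X ⟨S, S'⟩_{h_p} ω^n / n!`. -/
def LineMetric.sectionInner [MeasurableSpace X] (h : LineMetric L) (g : HermitianMetric n X)
    (p : ℕ) (S S' : ∀ x, ⨂[ℂ]^p (L x)) : ℂ :=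
  ∫ x, h.tensorInner p x (S x) (S' x) ∂g.vol

/-- `‖S‖_p^2 = (S, S)_p`. -/
def LineMetric.sectionNormSq [MeasurableSpace X] (h : LineMetric L) (g : HermitianMetric n X)
    (p : ℕ) (S : ∀ x, ⨂[ℂ]^p (L x)) : ℝ :=
  (h.sectionInner g p S S).re

/-- The space `H^0_0(X, L^p)` of the holomorphic sections of `L^p` vanishing to order at least
`⌊tp⌋` along `Y`. -/
abbrev partialSections (n : ℕ) [ChartedSpace (Fin n → ℂ) X] (L : X → Type*)
    [TopologicalSpace (Bundle.TotalSpace ℂ L)] [∀ x, AddCommGroup (L x)] [∀ x, Module ℂ (L x)]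
    [∀ x, TopologicalSpace (L x)] [FiberBundle ℂ L] [VectorBundle ℂ ℂ L]
    (Y : Set X) (t : ℝ) (p : ℕ) : Submodule ℂ (∀ x, ⨂[ℂ]^p (L x)) :=
  sectionsVanishing L n Y ⌊t * p⌋₊ p

/-- `b` is an orthonormal basis of `H^0_0(X, L^p)` for the `L^2` inner product `(·,·)_p`. -/
def IsOrthonormalSectionBasis [MeasurableSpace X] (h : LineMetric L) (g : HermitianMetric n X)
    (Y : Set X) (t : ℝ) (p : ℕ) {d : ℕ}
    (b : Module.Basis (Fin d) ℂ (partialSections n L Y t p)) : Prop :=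
  ∀ i j, h.sectionInner g p (b i : ∀ x, ⨂[ℂ]^p (L x)) (b j : ∀ x, ⨂[ℂ]^p (L x)) =
    if i = j then 1 else 0

open Classical in
/-- The partial Bergman kernel function `P_{0,p}(x) = ∑_j |S_j(x)|_{h_p}^2`, where `(S_j)` is an
orthonormal basis of `H^0_0(X, L^p)`. -/
def partialBergman [MeasurableSpace X] (h : LineMetric L) (g : HermitianMetric n X)
    (Y : Set X) (t : ℝ) (p : ℕ) (x : X) : ℝ :=
  if H : ∃ b : Module.Basis (Fin (Module.finrank ℂ (partialSections n L Y t p))) ℂ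
      (partialSections n L Y t p), IsOrthonormalSectionBasis h g Y t p b then
    ∑ i, h.tensorNormSq p x ((H.choose i : ∀ x, ⨂[ℂ]^p (L x)) x)
  else 0

/-- `‖h‖_∞ = max {1, sup_{Δ(y_j, 2)} |φ_j|}`, where `φ_j` is the weight of `h` with respect to the
frame `e j` on the coordinate neighbourhood `W_j`. -/
def LineMetric.supNorm [NeZero n] (h : LineMetric L) {Y : Set X} (𝒲 : AdaptedCover n Y)
    (e : Fin 𝒲.N → ∀ x, L x) : ℝ :=
  sSup ({1} ∪ ⋃ j, (fun x => |h.weight (e j) x|) '' 𝒲.polydisk j 2)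

/-- The set `U_t = {x ∈ W : (A e^{ρ(x)})^t e^{4 ‖h‖_∞} < 1}`, where `r` is the function `e^ρ` and
`M = ‖h‖_∞`. -/
def decaySet [NeZero n] {Y : Set X} (𝒲 : AdaptedCover n Y) (r : X → ℝ) (A t M : ℝ) : Set X :=
  {x ∈ 𝒲.W | (A * r x) ^ t * Real.exp (4 * M) < 1}

end LineBundle

end

/-!
In a chart `z` with `Y = {z₀ = 0}` and in a frame `e` of `L`, a section of `L^p` which vanishes to
order `k = ⌊t p⌋` along `Y` is `z₀^k u e^{⊗p}` with `u` holomorphic.  The function `u` is bounded on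
the polydisk of radius `1` by the `L²` norm of `z₀^k u` on the polydisk of radius `2`, *uniformly in
`k`* (`enorm_sq_mul_volume_le_lintegral_pow_mul`): by the maximum principle in `z₀` it is enough to
bound `u` where `|z₀| = 3/2`, and there the sub-mean value inequality only involves points with
`|z₀| ≥ 1`, where `|u| ≤ |z₀^k u|`.  Passing between `|z₀^k u|` and the norm `|S|_{h_p}` costs a
factor `e^{2pM}` each way if the weight of `h` is bounded by `M`, whence
`|S|² ≤ C |z₀|^{2k} e^{4pM} ‖S‖²` (`tensorNormSq_le_of_adapted`), with `C` depending only on the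
chart and on the volume form.

With `k = 0` and arbitrary charts, the same estimate bounds all evaluations `S ↦ S(x)` uniformly on
the compact manifold `X`.  Since the volume of `X` is finite, this makes the space of sections a
finite dimensional inner product space: the squares of the members of an orthonormal family have a
bounded sum, and integrating it over `X` bounds the number of members
(`finiteDimensional_of_evaluation_bound`).  Moreover, `P_{0,p}(x)` is the square of the norm of the
evaluation at `x`, so that it is independent of the basis and inherits every bound on `|S(x)|²`
(`partialBergman_le`).

Adapted charts exist near `Y` by the inverse function theorem, which gives the decay near `Y`.  For
the precise estimates, `|z₀| ≤ B |s|` for a canonical section `s`, because `s` vanishes to first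
order only (`IsCanonicalSection.exists_norm_coord_le`).  The exponent is handled by
`⌊t p⌋ ≥ t p - 1 ≥ t p / 2` for `p > 2 / t`.

The volume measure is a supremum over all charts.  It is bounded below by each chart volume by
definition; the bound from above, which gives finiteness and measurability, is the change of
variables formula (`HermitianMetric.chartVolume_le_of_subset`).
-/

open MeasureTheory Set Metric

/-! ### Coordinate vector fields and the volume density -/

theorem vec_eq_sum_single {n : ℕ} (c : Fin n → ℂ) :
    c = ∑ j, c j • (Pi.single j 1 : Fin n → ℂ) := by
  ext i
  simp [Finset.sum_apply, Pi.single_apply]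

section Charts

variable {n : ℕ} {X : Type*} [TopologicalSpace X] [ChartedSpace (Fin n → ℂ) X]

/-- All tangent spaces are `Fin n → ℂ` by definition, so that the metric at equal points can be
compared on the same vectors. -/
theorem HermitianMetric.inner_congr (g : HermitianMetric n X) {x y : X} (hxy : x = y)
    (u v : Fin n → ℂ) :
    g.inner x (show TangentSpace 𝓘(ℂ, Fin n → ℂ) x from u)
      (show TangentSpace 𝓘(ℂ, Fin n → ℂ) x from v) =
    g.inner y (show TangentSpace 𝓘(ℂ, Fin n → ℂ) y from u)
      (show TangentSpace 𝓘(ℂ, Fin n → ℂ) y from v) := by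
  subst hxy; rfl

theorem contDiffOn_chart_comp_symm [IsManifold 𝓘(ℂ, Fin n → ℂ) ω X]
    {φ ψ : OpenPartialHomeomorph X (Fin n → ℂ)}
    (hφ : φ ∈ IsManifold.maximalAtlas 𝓘(ℂ, Fin n → ℂ) ω X)
    (hψ : ψ ∈ IsManifold.maximalAtlas 𝓘(ℂ, Fin n → ℂ) ω X) :
    ContDiffOn ℂ ω (ψ ∘ φ.symm) (φ.target ∩ φ.symm ⁻¹' ψ.source) := by
  rw [← contMDiffOn_iff_contDiffOn]
  exact (contMDiffOn_of_mem_maximalAtlas hψ).comp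
    ((contMDiffOn_symm_of_mem_maximalAtlas hφ).mono inter_subset_left) fun z hz => hz.2

/-- The coordinate vector fields of two charts are related by the Jacobian matrix of the
transition map. -/
theorem coordVector_eq_sum [IsManifold 𝓘(ℂ, Fin n → ℂ) ω X]
    {φ ψ : OpenPartialHomeomorph X (Fin n → ℂ)}
    (hφ : φ ∈ IsManifold.maximalAtlas 𝓘(ℂ, Fin n → ℂ) ω X)
    (hψ : ψ ∈ IsManifold.maximalAtlas 𝓘(ℂ, Fin n → ℂ) ω X)
    {z : Fin n → ℂ} (hz : z ∈ φ.target ∩ φ.symm ⁻¹' ψ.source) (j : Fin n) :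
    (show Fin n → ℂ from coordVector φ z j) =
      ∑ k, fderiv ℂ (ψ ∘ φ.symm) z (Pi.single j 1) k •
        (show Fin n → ℂ from coordVector ψ ((ψ ∘ φ.symm) z) k) := by
  have hΩ := (φ.isOpen_inter_preimage_symm ψ.open_source).mem_nhds hz
  have hT : DifferentiableAt ℂ (ψ ∘ φ.symm) z :=
    ((contDiffOn_chart_comp_symm hφ hψ).contDiffAt hΩ).differentiableAt (by simp)
  have hTz : (ψ ∘ φ.symm) z ∈ ψ.target := ψ.map_source hz.2
  have hψs : MDifferentiableAt 𝓘(ℂ, Fin n → ℂ) 𝓘(ℂ, Fin n → ℂ) ψ.symm ((ψ ∘ φ.symm) z) :=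
    (contMDiffAt_symm_of_mem_maximalAtlas hψ hTz).mdifferentiableAt (by simp)
  have heq : φ.symm =ᶠ[𝓝 z] ψ.symm ∘ (ψ ∘ φ.symm) := by
    filter_upwards [hΩ] with w hw
    exact (ψ.left_inv hw.2).symm
  have hcomp : mfderiv 𝓘(ℂ, Fin n → ℂ) 𝓘(ℂ, Fin n → ℂ) φ.symm z =
      (mfderiv 𝓘(ℂ, Fin n → ℂ) 𝓘(ℂ, Fin n → ℂ) ψ.symm ((ψ ∘ φ.symm) z)).comp
        (mfderiv 𝓘(ℂ, Fin n → ℂ) 𝓘(ℂ, Fin n → ℂ) (ψ ∘ φ.symm) z) := by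
    rw [← mfderiv_comp z hψs hT.mdifferentiableAt]
    exact heq.mfderiv_eq
  set D : (Fin n → ℂ) →L[ℂ] (Fin n → ℂ) :=
    mfderiv 𝓘(ℂ, Fin n → ℂ) 𝓘(ℂ, Fin n → ℂ) ψ.symm ((ψ ∘ φ.symm) z) with hD
  have h1 : (show Fin n → ℂ from coordVector φ z j) =
      D (fderiv ℂ (ψ ∘ φ.symm) z (Pi.single j 1)) := by
    rw [hD, ← mfderiv_eq_fderiv]
    exact congrArg (fun A : (Fin n → ℂ) →L[ℂ] (Fin n → ℂ) => A (Pi.single j 1)) hcomp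
  rw [h1]
  conv_lhs => rw [vec_eq_sum_single (fderiv ℂ (ψ ∘ φ.symm) z (Pi.single j 1)), map_sum]
  simp only [map_smul]
  rfl

/-- The Jacobian matrix of the transition map from `φ` to `ψ`. -/
noncomputable def transitionMatrix (φ ψ : OpenPartialHomeomorph X (Fin n → ℂ)) (z : Fin n → ℂ) :
    Matrix (Fin n) (Fin n) ℂ :=
  LinearMap.toMatrix' (fderiv ℂ (ψ ∘ φ.symm) z : (Fin n → ℂ) →ₗ[ℂ] (Fin n → ℂ))

theorem HermitianMetric.gram_eq_conjTranspose_mul [IsManifold 𝓘(ℂ, Fin n → ℂ) ω X]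
    (g : HermitianMetric n X) {φ ψ : OpenPartialHomeomorph X (Fin n → ℂ)}
    (hφ : φ ∈ IsManifold.maximalAtlas 𝓘(ℂ, Fin n → ℂ) ω X)
    (hψ : ψ ∈ IsManifold.maximalAtlas 𝓘(ℂ, Fin n → ℂ) ω X)
    {z : Fin n → ℂ} (hz : z ∈ φ.target ∩ φ.symm ⁻¹' ψ.source) :
    g.gram φ z = (transitionMatrix φ ψ z).conjTranspose * g.gram ψ ((ψ ∘ φ.symm) z) *
      transitionMatrix φ ψ z := by
  ext j k
  have hx : φ.symm z = ψ.symm ((ψ ∘ φ.symm) z) := (ψ.left_inv hz.2).symm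
  have h1 := g.inner_congr hx (coordVector φ z j) (coordVector φ z k)
  have e1 : g.gram φ z j k = g.inner (φ.symm z) (coordVector φ z j) (coordVector φ z k) := rfl
  rw [e1]
  refine h1.trans ?_
  rw [show (coordVector φ z j : Fin n → ℂ) = _ from coordVector_eq_sum hφ hψ hz j,
    show (coordVector φ z k : Fin n → ℂ) = _ from coordVector_eq_sum hφ hψ hz k]
  have h2 : ∀ (c d : Fin n → ℂ)
      (u : Fin n → TangentSpace 𝓘(ℂ, Fin n → ℂ) (ψ.symm ((ψ ∘ φ.symm) z))),
      g.inner (ψ.symm ((ψ ∘ φ.symm) z)) (∑ a, c a • u a) (∑ b, d b • u b) =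
        ∑ b, ∑ a, conj (c a) * g.inner _ (u a) (u b) * d b := by
    intro c d u
    simp only [map_sum, LinearMap.sum_apply, map_smul, LinearMap.map_smulₛₗ, LinearMap.smul_apply,
      smul_eq_mul, Finset.mul_sum]
    refine Finset.sum_congr rfl fun b _ => Finset.sum_congr rfl fun a _ => ?_
    ring
  refine (h2 _ _ _).trans ?_
  simp only [Matrix.mul_apply, Finset.sum_mul, Matrix.conjTranspose_apply]
  rfl

/-- The volume densities of two charts differ by the squared modulus of the complex Jacobian
determinant. -/
theorem HermitianMetric.det_gram_eq [IsManifold 𝓘(ℂ, Fin n → ℂ) ω X]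
    (g : HermitianMetric n X) {φ ψ : OpenPartialHomeomorph X (Fin n → ℂ)}
    (hφ : φ ∈ IsManifold.maximalAtlas 𝓘(ℂ, Fin n → ℂ) ω X)
    (hψ : ψ ∈ IsManifold.maximalAtlas 𝓘(ℂ, Fin n → ℂ) ω X)
    {z : Fin n → ℂ} (hz : z ∈ φ.target ∩ φ.symm ⁻¹' ψ.source) :
    (g.gram φ z).det.re = ‖(fderiv ℂ (ψ ∘ φ.symm) z).det‖ ^ 2 *
      (g.gram ψ ((ψ ∘ φ.symm) z)).det.re := by
  rw [g.gram_eq_conjTranspose_mul hφ hψ hz, Matrix.det_mul, Matrix.det_mul,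
    Matrix.det_conjTranspose]
  have h1 : (transitionMatrix φ ψ z).det = (fderiv ℂ (ψ ∘ φ.symm) z).det := by
    rw [transitionMatrix, LinearMap.det_toMatrix']
  rw [h1, mul_right_comm]
  have : star (fderiv ℂ (ψ ∘ φ.symm) z).det * (fderiv ℂ (ψ ∘ φ.symm) z).det =
      ((‖(fderiv ℂ (ψ ∘ φ.symm) z).det‖ ^ 2 : ℝ) : ℂ) := by
    have := Complex.mul_conj (fderiv ℂ (ψ ∘ φ.symm) z).det
    rw [Complex.normSq_eq_norm_sq] at this
    rw [mul_comm]; exact this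
  rw [this, Complex.re_ofReal_mul]

/-- The coordinate vector fields are linearly independent: the differential of the chart inverts
that of its inverse. -/
theorem coordVector_combination_ne_zero [IsManifold 𝓘(ℂ, Fin n → ℂ) ω X]
    {φ : OpenPartialHomeomorph X (Fin n → ℂ)}
    (hφ : φ ∈ IsManifold.maximalAtlas 𝓘(ℂ, Fin n → ℂ) ω X)
    {z : Fin n → ℂ} (hz : z ∈ φ.target) {c : Fin n → ℂ} (hc : c ≠ 0) :
    ∑ j, c j • coordVector φ z j ≠ 0 := by
  have h1 : ∑ j, c j • coordVector φ z j =
      mfderiv 𝓘(ℂ, Fin n → ℂ) 𝓘(ℂ, Fin n → ℂ) φ.symm z (show Fin n → ℂ from c) := by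
    conv_rhs => rw [vec_eq_sum_single c]
    set D : (Fin n → ℂ) →L[ℂ] (Fin n → ℂ) :=
      mfderiv 𝓘(ℂ, Fin n → ℂ) 𝓘(ℂ, Fin n → ℂ) φ.symm z with hD
    have h3 : D (∑ j, c j • (Pi.single j 1 : Fin n → ℂ)) = ∑ j, c j • D (Pi.single j 1) := by
      rw [map_sum]; simp only [map_smul]
    exact h3.symm
  rw [h1]
  intro h0
  have hs : MDifferentiableAt 𝓘(ℂ, Fin n → ℂ) 𝓘(ℂ, Fin n → ℂ) φ.symm z :=
    (contMDiffAt_symm_of_mem_maximalAtlas hφ hz).mdifferentiableAt (by simp)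
  have hf : MDifferentiableAt 𝓘(ℂ, Fin n → ℂ) 𝓘(ℂ, Fin n → ℂ) φ (φ.symm z) :=
    (contMDiffAt_of_mem_maximalAtlas hφ (φ.map_target hz)).mdifferentiableAt (by simp)
  have hid : (φ ∘ φ.symm) =ᶠ[𝓝 z] id := by
    filter_upwards [φ.open_target.mem_nhds hz] with w hw using φ.right_inv hw
  have h2 := mfderiv_comp z hf hs
  rw [hid.mfderiv_eq] at h2
  have h3 : (fderiv ℂ (id : (Fin n → ℂ) → (Fin n → ℂ)) z) c =
      (mfderiv 𝓘(ℂ, Fin n → ℂ) 𝓘(ℂ, Fin n → ℂ) φ (φ.symm z))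
        (mfderiv 𝓘(ℂ, Fin n → ℂ) 𝓘(ℂ, Fin n → ℂ) φ.symm z (show Fin n → ℂ from c)) := by
    rw [← mfderiv_eq_fderiv]
    exact congrArg (fun A : (Fin n → ℂ) →L[ℂ] (Fin n → ℂ) => A c) h2
  rw [h0, map_zero] at h3
  simp only [fderiv_id] at h3
  exact hc h3

open scoped ComplexOrder in
theorem HermitianMetric.det_gram_pos [IsManifold 𝓘(ℂ, Fin n → ℂ) ω X]
    (g : HermitianMetric n X) {φ : OpenPartialHomeomorph X (Fin n → ℂ)}
    (hφ : φ ∈ IsManifold.maximalAtlas 𝓘(ℂ, Fin n → ℂ) ω X)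
    {z : Fin n → ℂ} (hz : z ∈ φ.target) : 0 < (g.gram φ z).det.re := by
  have hpd : (g.gram φ z).PosDef := by
    refine Matrix.PosDef.of_dotProduct_mulVec_pos ?_ ?_
    · ext j k
      exact g.conj_symm _ _ _
    · intro c hc
      have hq : star c ⬝ᵥ (g.gram φ z).mulVec c =
          g.inner (φ.symm z) (∑ j, c j • coordVector φ z j) (∑ j, c j • coordVector φ z j) := by
        simp only [map_sum, LinearMap.sum_apply, map_smul, LinearMap.map_smulₛₗ,
          LinearMap.smul_apply, smul_eq_mul, dotProduct, Matrix.mulVec, Finset.mul_sum]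
        rw [Finset.sum_comm]
        refine Finset.sum_congr rfl fun b _ => Finset.sum_congr rfl fun a _ => ?_
        simp only [HermitianMetric.gram, Matrix.of_apply, Pi.star_apply, RCLike.star_def]
        ring
      rw [hq, Complex.pos_iff]
      refine ⟨g.pos _ _ (coordVector_combination_ne_zero hφ hz hc), ?_⟩
      have := congrArg Complex.im (g.conj_symm (φ.symm z) (∑ j, c j • coordVector φ z j)
        (∑ j, c j • coordVector φ z j))
      rw [Complex.conj_im] at this
      linarith
  exact (Complex.pos_iff.1 hpd.det_pos).1

theorem HermitianMetric.continuousOn_det_gram [IsManifold 𝓘(ℂ, Fin n → ℂ) ω X]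
    (g : HermitianMetric n X) {φ : OpenPartialHomeomorph X (Fin n → ℂ)}
    (hφ : φ ∈ IsManifold.maximalAtlas 𝓘(ℂ, Fin n → ℂ) ω X) :
    ContinuousOn (fun z => (g.gram φ z).det.re) φ.target := by
  refine Complex.continuous_re.comp_continuousOn ?_
  have : ContinuousOn (fun z => g.gram φ z) φ.target :=
    continuousOn_pi.2 fun j => continuousOn_pi.2 fun k => (g.smooth φ hφ j k).continuousOn
  exact (Continuous.matrix_det continuous_id).comp_continuousOn this

end Charts

/-! ### The volume measure -/

theorem abs_det_restrictScalars {n : ℕ} (A : (Fin n → ℂ) →L[ℂ] (Fin n → ℂ)) :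
    |(A.restrictScalars ℝ).det| = ‖A.det‖ ^ 2 := by
  have h : (A.restrictScalars ℝ).det = Algebra.norm ℝ A.det := by
    exact LinearMap.det_restrictScalars (R := ℝ) (S := ℂ) (f := (A : (Fin n → ℂ) →ₗ[ℂ] (Fin n → ℂ)))
  rw [h, Algebra.norm_complex_apply, Complex.normSq_eq_norm_sq, abs_of_nonneg (by positivity)]

theorem ContinuousOn.measurableSet_inter_preimage {α β : Type*} [TopologicalSpace α]
    [MeasurableSpace α] [OpensMeasurableSpace α] [TopologicalSpace β] [MeasurableSpace β]
    [BorelSpace β] {f : α → β} {s : Set α} {t : Set β} (hf : ContinuousOn f s)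
    (hs : MeasurableSet s) (ht : MeasurableSet t) : MeasurableSet (s ∩ f ⁻¹' t) := by
  have h1 : MeasurableSet (s.domRestrict f ⁻¹' t) :=
    (continuousOn_iff_continuous_domRestrict.1 hf).measurable ht
  have h2 := hs.subtype_image h1
  rwa [show (fun x : s => (x : α)) '' (s.domRestrict f ⁻¹' t) = s ∩ f ⁻¹' t by
    ext x; simp [Set.domRestrict, and_comm]] at h2

theorem HermitianMetric.chartVolume_le_vol {n : ℕ} {X : Type*} [TopologicalSpace X]
    [ChartedSpace (Fin n → ℂ) X] [MeasurableSpace X] (g : HermitianMetric n X)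
    {φ : OpenPartialHomeomorph X (Fin n → ℂ)}
    (hφ : φ ∈ IsManifold.maximalAtlas 𝓘(ℂ, Fin n → ℂ) ω X) : g.chartVolume φ ≤ g.vol :=
  le_iSup₂ (f := fun φ (_ : φ ∈ IsManifold.maximalAtlas 𝓘(ℂ, Fin n → ℂ) ω X) => g.chartVolume φ)
    φ hφ

section Volume

variable {n : ℕ} {X : Type*} [TopologicalSpace X] [ChartedSpace (Fin n → ℂ) X]
  [MeasurableSpace X] [BorelSpace X]

theorem OpenPartialHomeomorph.aemeasurable_symm_withDensity {X : Type*} [TopologicalSpace X]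
    [MeasurableSpace X] [BorelSpace X] {n : ℕ} (φ : OpenPartialHomeomorph X (Fin n → ℂ))
    (f : (Fin n → ℂ) → ENNReal) :
    AEMeasurable φ.symm ((volume.restrict φ.target).withDensity f) :=
  (φ.continuousOn_symm.aemeasurable φ.open_target.measurableSet).mono_ac
    (withDensity_absolutelyContinuous _ _)

theorem HermitianMetric.chartVolume_apply (g : HermitianMetric n X)
    (φ : OpenPartialHomeomorph X (Fin n → ℂ)) {E : Set X} (hE : MeasurableSet E) :
    g.chartVolume φ E =
      ∫⁻ z in φ.target ∩ φ.symm ⁻¹' E, ENNReal.ofReal (g.gram φ z).det.re := by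
  rw [chartVolume, Measure.map_apply_of_aemeasurable (φ.aemeasurable_symm_withDensity _) hE,
    withDensity_apply', Measure.restrict_restrict' φ.open_target.measurableSet, inter_comm]

theorem HermitianMetric.chartVolume_restrict (g : HermitianMetric n X)
    (φ : OpenPartialHomeomorph X (Fin n → ℂ)) {E : Set X} (hE : MeasurableSet E) :
    (g.chartVolume φ).restrict E =
      ((volume.restrict (φ.target ∩ φ.symm ⁻¹' E)).withDensity
        fun z => ENNReal.ofReal (g.gram φ z).det.re).map φ.symm := by
  refine Measure.ext fun A hA => ?_
  have h1 : AEMeasurable φ.symm ((volume.restrict (φ.target ∩ φ.symm ⁻¹' E)).withDensity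
        fun z => ENNReal.ofReal (g.gram φ z).det.re) :=
    ((φ.continuousOn_symm.aemeasurable φ.open_target.measurableSet).mono_set
      inter_subset_left).mono_ac (withDensity_absolutelyContinuous _ _)
  have h2 : MeasurableSet (φ.target ∩ φ.symm ⁻¹' E) :=
    φ.continuousOn_symm.measurableSet_inter_preimage φ.open_target.measurableSet hE
  rw [Measure.restrict_apply hA, g.chartVolume_apply φ (hA.inter hE),
    Measure.map_apply_of_aemeasurable h1 hA, withDensity_apply', Measure.restrict_restrict' h2]
  congr 2
  ext z; simp only [mem_inter_iff, mem_preimage]; tauto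

theorem HermitianMetric.map_chartVolume_restrict (g : HermitianMetric n X)
    (φ : OpenPartialHomeomorph X (Fin n → ℂ)) {E : Set X} (hE : MeasurableSet E)
    (hEφ : E ⊆ φ.source) :
    ((g.chartVolume φ).restrict E).map φ =
      (volume.restrict (φ.target ∩ φ.symm ⁻¹' E)).withDensity
        fun z => ENNReal.ofReal (g.gram φ z).det.re := by
  have h1 : AEMeasurable φ.symm ((volume.restrict (φ.target ∩ φ.symm ⁻¹' E)).withDensity
        fun z => ENNReal.ofReal (g.gram φ z).det.re) :=
    ((φ.continuousOn_symm.aemeasurable φ.open_target.measurableSet).mono_set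
      inter_subset_left).mono_ac (withDensity_absolutelyContinuous _ _)
  have h0 : AEMeasurable φ ((g.chartVolume φ).restrict E) :=
    (φ.continuousOn.mono hEφ).aemeasurable hE
  have h2 : MeasurableSet (φ.target ∩ φ.symm ⁻¹' E) :=
    φ.continuousOn_symm.measurableSet_inter_preimage φ.open_target.measurableSet hE
  rw [g.chartVolume_restrict φ hE] at h0 ⊢
  rw [AEMeasurable.map_map_of_aemeasurable h0 h1]
  conv_rhs => rw [← Measure.map_id (μ := (volume.restrict (φ.target ∩ φ.symm ⁻¹' E)).withDensity
        fun z => ENNReal.ofReal (g.gram φ z).det.re)]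
  refine Measure.map_congr ?_
  refine (withDensity_absolutelyContinuous _ _).ae_le ?_
  filter_upwards [ae_restrict_mem h2] with z hz using φ.right_inv hz.1

variable [IsManifold 𝓘(ℂ, Fin n → ℂ) ω X]

/-- The volume forms of the charts agree on overlaps: this is the change of variables formula, as
the real Jacobian determinant of the transition map is the square of the modulus of the complex
one. -/
theorem HermitianMetric.chartVolume_le_of_subset (g : HermitianMetric n X)
    {φ ψ : OpenPartialHomeomorph X (Fin n → ℂ)}
    (hφ : φ ∈ IsManifold.maximalAtlas 𝓘(ℂ, Fin n → ℂ) ω X)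
    (hψ : ψ ∈ IsManifold.maximalAtlas 𝓘(ℂ, Fin n → ℂ) ω X)
    {E : Set X} (hE : MeasurableSet E) (hEψ : E ⊆ ψ.source) :
    g.chartVolume φ E ≤ g.chartVolume ψ E := by
  rw [g.chartVolume_apply φ hE, g.chartVolume_apply ψ hE]
  set s := φ.target ∩ φ.symm ⁻¹' E with hs
  have hsm : MeasurableSet s :=
    φ.continuousOn_symm.measurableSet_inter_preimage φ.open_target.measurableSet hE
  have hsΩ : s ⊆ φ.target ∩ φ.symm ⁻¹' ψ.source := fun z hz => ⟨hz.1, hEψ hz.2⟩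
  have hd : ∀ z ∈ s, HasFDerivWithinAt (ψ ∘ φ.symm)
      ((fderiv ℂ (ψ ∘ φ.symm) z).restrictScalars ℝ) s z := fun z hz =>
    ((((contDiffOn_chart_comp_symm hφ hψ).contDiffAt
      ((φ.isOpen_inter_preimage_symm ψ.open_source).mem_nhds (hsΩ hz))).differentiableAt
        (by simp)).hasFDerivAt.restrictScalars ℝ).hasFDerivWithinAt
  have hinj : InjOn (ψ ∘ φ.symm) s := fun z hz w hw hzw =>
    φ.symm.injOn hz.1 hw.1 (ψ.injOn (hsΩ hz).2 (hsΩ hw).2 hzw)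
  calc ∫⁻ z in s, ENNReal.ofReal (g.gram φ z).det.re
      = ∫⁻ z in s, ENNReal.ofReal |((fderiv ℂ (ψ ∘ φ.symm) z).restrictScalars ℝ).det| *
          ENNReal.ofReal (g.gram ψ ((ψ ∘ φ.symm) z)).det.re := by
        refine setLIntegral_congr_fun hsm fun z hz => ?_
        rw [g.det_gram_eq hφ hψ (hsΩ hz), abs_det_restrictScalars,
          ENNReal.ofReal_mul (by positivity)]
    _ = ∫⁻ w in (ψ ∘ φ.symm) '' s, ENNReal.ofReal (g.gram ψ w).det.re :=
        (lintegral_image_eq_lintegral_abs_det_fderiv_mul volume hsm hd hinj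
          fun w => ENNReal.ofReal (g.gram ψ w).det.re).symm
    _ ≤ _ := by
        refine lintegral_mono_set ?_
        rintro _ ⟨z, hz, rfl⟩
        refine ⟨ψ.map_source (hsΩ hz).2, ?_⟩
        simp only [Function.comp, mem_preimage, ψ.left_inv (hsΩ hz).2]
        exact hz.2

/-- The glued measure is not larger than the volume of a chart, on the domain of the chart. -/
theorem HermitianMetric.vol_restrict_le (g : HermitianMetric n X)
    {φ : OpenPartialHomeomorph X (Fin n → ℂ)}
    (hφ : φ ∈ IsManifold.maximalAtlas 𝓘(ℂ, Fin n → ℂ) ω X) {E : Set X} (hE : MeasurableSet E)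
    (hEφ : E ⊆ φ.source) : g.vol.restrict E ≤ (g.chartVolume φ).restrict E := by
  -- the measure which is infinite off `E` bounds all chart volumes, hence their supremum
  have h : g.vol ≤ (g.chartVolume φ).restrict E + (⊤ : Measure X).restrict Eᶜ := by
    refine iSup₂_le fun ψ hψ => ?_
    rw [← Measure.restrict_add_restrict_compl (μ := g.chartVolume ψ) hE]
    refine add_le_add ?_ (Measure.restrict_mono subset_rfl le_top)
    refine Measure.le_iff.2 fun A hA => ?_
    rw [Measure.restrict_apply hA, Measure.restrict_apply hA]
    exact g.chartVolume_le_of_subset hψ hφ (hA.inter hE) (inter_subset_right.trans hEφ)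
  refine Measure.le_iff.2 fun A hA => ?_
  rw [Measure.restrict_apply hA]
  refine (h _).trans_eq ?_
  rw [Measure.add_apply, Measure.restrict_apply (hA.inter hE), Measure.restrict_apply (hA.inter hE),
    Measure.restrict_apply hA, inter_assoc, inter_assoc, inter_compl_self, inter_self]
  simp

theorem HermitianMetric.isFiniteMeasure_vol [CompactSpace X] (g : HermitianMetric n X) :
    IsFiniteMeasure g.vol := by
  have : IsLocallyFiniteMeasure g.vol := by
    refine ⟨fun x => ?_⟩
    set φ := chartAt (Fin n → ℂ) x
    have hφ : φ ∈ IsManifold.maximalAtlas 𝓘(ℂ, Fin n → ℂ) ω X := IsManifold.chart_mem_maximalAtlas x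
    have hx : x ∈ φ.source := mem_chart_source _ x
    obtain ⟨r, hr, hrt⟩ := nhds_basis_closedBall.mem_iff.1
      (φ.open_target.mem_nhds (φ.map_source hx))
    have hE : IsOpen (φ.source ∩ φ ⁻¹' ball (φ x) r) := φ.isOpen_inter_preimage isOpen_ball
    refine ⟨φ.source ∩ φ ⁻¹' ball (φ x) r, hE.mem_nhds ⟨hx, mem_ball_self hr⟩, ?_⟩
    have h1 := g.vol_restrict_le hφ hE.measurableSet inter_subset_left univ
    rw [Measure.restrict_apply_univ, Measure.restrict_apply_univ,
      g.chartVolume_apply φ hE.measurableSet] at h1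
    refine h1.trans_lt ?_
    obtain ⟨B, hB⟩ := (isCompact_closedBall (φ x) r).exists_bound_of_continuousOn
      ((g.continuousOn_det_gram hφ).mono hrt)
    have hsub : φ.target ∩ φ.symm ⁻¹' (φ.source ∩ φ ⁻¹' ball (φ x) r) ⊆ closedBall (φ x) r := by
      rintro z ⟨hz, -, hz'⟩
      rw [mem_preimage, φ.right_inv hz] at hz'
      exact ball_subset_closedBall hz'
    calc _ ≤ ∫⁻ z in closedBall (φ x) r, ENNReal.ofReal (g.gram φ z).det.re :=
          lintegral_mono_set hsub
      _ ≤ ∫⁻ z in closedBall (φ x) r, ENNReal.ofReal B := by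
          refine setLIntegral_mono measurable_const fun z hz => ?_
          exact ENNReal.ofReal_le_ofReal ((le_abs_self _).trans (hB z hz))
      _ < ⊤ := by
          rw [setLIntegral_const]
          exact ENNReal.mul_lt_top ENNReal.ofReal_lt_top
            (isCompact_closedBall (φ x) r).measure_lt_top
  infer_instance

/-- On a set where the volume density is at least `δ`, integrals
over `X` dominate `δ` times Lebesgue integrals. -/
theorem HermitianMetric.mul_setLIntegral_le (g : HermitianMetric n X)
    {φ : OpenPartialHomeomorph X (Fin n → ℂ)}
    (hφ : φ ∈ IsManifold.maximalAtlas 𝓘(ℂ, Fin n → ℂ) ω X) {K : Set (Fin n → ℂ)}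
    (hK : MeasurableSet K) (hKφ : K ⊆ φ.target) {δ : ℝ} (hδ : ∀ z ∈ K, δ ≤ (g.gram φ z).det.re)
    {F : X → ENNReal} (hF : ContinuousOn F φ.source) :
    ENNReal.ofReal δ * ∫⁻ z in K, F (φ.symm z) ≤ ∫⁻ x in φ.symm '' K, F x ∂g.vol := by
  have hEeq : φ.symm '' K = φ.source ∩ φ ⁻¹' K := φ.symm.image_eq_target_inter_inv_preimage hKφ
  have hE : MeasurableSet (φ.symm '' K) := by
    rw [hEeq]
    exact φ.continuousOn.measurableSet_inter_preimage φ.open_source.measurableSet hK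
  have hEs : φ.symm '' K ⊆ φ.source := hEeq ▸ inter_subset_left
  have hKeq : φ.target ∩ φ.symm ⁻¹' (φ.symm '' K) = K := by
    ext z
    refine ⟨?_, fun hz => ⟨hKφ hz, mem_image_of_mem _ hz⟩⟩
    rintro ⟨hz, w, hw, hwz⟩
    rwa [← φ.symm.injOn (hKφ hw) hz hwz]
  have hFs : ContinuousOn (F ∘ φ.symm) K :=
    hF.comp (φ.continuousOn_symm.mono hKφ) fun z hz => φ.map_target (hKφ hz)
  have hFE : AEMeasurable F ((g.chartVolume φ).restrict (φ.symm '' K)) :=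
    (hF.mono hEs).aemeasurable hE
  have hs1 : AEMeasurable φ.symm ((volume.restrict K).withDensity
        fun z => ENNReal.ofReal (g.gram φ z).det.re) :=
    ((φ.continuousOn_symm.aemeasurable φ.open_target.measurableSet).mono_set
      hKφ).mono_ac (withDensity_absolutelyContinuous _ _)
  have hdm : AEMeasurable (fun z => ENNReal.ofReal (g.gram φ z).det.re) (volume.restrict K) :=
    (((g.continuousOn_det_gram hφ).mono hKφ).aemeasurable hK).ennreal_ofReal
  calc ENNReal.ofReal δ * ∫⁻ z in K, F (φ.symm z)
      = ∫⁻ z in K, ENNReal.ofReal δ * F (φ.symm z) :=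
        (lintegral_const_mul'' _ (hFs.aemeasurable hK)).symm
    _ ≤ ∫⁻ z in K, ENNReal.ofReal (g.gram φ z).det.re * F (φ.symm z) := by
        refine lintegral_mono_ae ?_
        filter_upwards [ae_restrict_mem hK] with z hz
        gcongr
        exact hδ z hz
    _ = ∫⁻ x in φ.symm '' K, F x ∂g.chartVolume φ := by
        rw [g.chartVolume_restrict φ hE, hKeq] at *
        rw [lintegral_map' hFE hs1]
        exact (lintegral_withDensity_eq_lintegral_mul₀ hdm (hFs.aemeasurable hK)).symm
    _ ≤ ∫⁻ x in φ.symm '' K, F x ∂g.vol :=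
        lintegral_mono' (Measure.restrict_mono subset_rfl (g.chartVolume_le_vol hφ)) le_rfl

/-- Measurability for the volume measure can be tested in charts for Lebesgue measure. -/
theorem HermitianMetric.aemeasurable_of_comp_symm {β : Type*} [MeasurableSpace β]
    (g : HermitianMetric n X)
    {φ : OpenPartialHomeomorph X (Fin n → ℂ)}
    (hφ : φ ∈ IsManifold.maximalAtlas 𝓘(ℂ, Fin n → ℂ) ω X) {E : Set X} (hE : MeasurableSet E)
    (hEφ : E ⊆ φ.source) {F : X → β}
    (hF : AEMeasurable (fun z => F (φ.symm z)) (volume.restrict (φ.target ∩ φ.symm ⁻¹' E))) :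
    AEMeasurable F (g.vol.restrict E) := by
  refine AEMeasurable.mono_measure ?_ (g.vol_restrict_le hφ hE hEφ)
  have h0 : AEMeasurable φ ((g.chartVolume φ).restrict E) :=
    (φ.continuousOn.mono hEφ).aemeasurable hE
  have h1 : AEMeasurable (fun z => F (φ.symm z)) (((g.chartVolume φ).restrict E).map φ) := by
    rw [g.map_chartVolume_restrict φ hE hEφ]
    exact hF.mono_ac (withDensity_absolutelyContinuous _ _)
  refine (h1.comp_aemeasurable h0).congr ?_
  filter_upwards [ae_restrict_mem hE] with x hx
  simp [φ.left_inv (hEφ hx)]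

end Volume

/-! ### Local `L²` estimates for holomorphic functions -/

section SubMean

variable {n : ℕ}

theorem measurePreserving_circle_smul (a : Circle) :
    MeasurePreserving (fun v : Fin n → ℂ => (a : ℂ) • v) := by
  have h := volume_preserving_pi (α' := fun _ : Fin n => ℂ) (β' := fun _ : Fin n => ℂ)
    (f := fun _ : Fin n => rotation a) fun _ => (rotation a).measurePreserving
  exact h

/-- The mean value property of the holomorphic function `l ↦ f (c + l • v) ^ 2` on the unit disc,
as an inequality. -/
theorem enorm_sq_mul_le_lintegral_circle {f : (Fin n → ℂ) → ℂ} {U : Set (Fin n → ℂ)}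
    (hU : IsOpen U) (hf : DifferentiableOn ℂ f U) {c : Fin n → ℂ} {r : ℝ}
    (hr : closedBall c r ⊆ U) {v : Fin n → ℂ} (hv : ‖v‖ ≤ r) :
    ‖f c‖ₑ ^ 2 * ENNReal.ofReal (2 * Real.pi) ≤
      ∫⁻ θ in Ioc 0 (2 * Real.pi), ‖f (c + circleMap 0 1 θ • v)‖ₑ ^ 2 := by
  have hmem : ∀ l : ℂ, ‖l‖ ≤ 1 → c + l • v ∈ closedBall c r := fun l hl => by
    rw [mem_closedBall, dist_eq_norm, add_sub_cancel_left, norm_smul]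
    nlinarith [norm_nonneg v, norm_nonneg l]
  have hd : DiffContOnCl ℂ (fun l : ℂ => f (c + l • v) ^ 2) (ball 0 |1|) := by
    refine DifferentiableOn.diffContOnCl fun l hl => ?_
    rw [abs_one, closure_ball _ one_ne_zero, mem_closedBall_zero_iff] at hl
    have h1 : DifferentiableAt ℂ f (c + l • v) :=
      (hf _ (hr (hmem l hl))).differentiableAt (hU.mem_nhds (hr (hmem l hl)))
    have h2 : DifferentiableAt ℂ (fun l : ℂ => c + l • v) l := by fun_prop
    exact ((h1.comp l h2).pow 2).differentiableWithinAt
  have h := hd.circleAverage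
  rw [Real.circleAverage_def, intervalIntegral.integral_of_le (by positivity)] at h
  have hpi : (0 : ℝ) < 2 * Real.pi := by positivity
  have h3 : ((2 * Real.pi : ℝ) : ℂ) * f c ^ 2 =
      ∫ θ in Ioc 0 (2 * Real.pi), f (c + circleMap 0 1 θ • v) ^ 2 := by
    simp only [zero_smul, add_zero, Complex.real_smul] at h
    rw [← h, ← mul_assoc, ← Complex.ofReal_mul, mul_inv_cancel₀ hpi.ne']
    simp
  have h4 := congrArg (fun z : ℂ => ‖z‖ₑ) h3
  simp only [enorm_mul, enorm_pow] at h4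
  have h5 : ‖((2 * Real.pi : ℝ) : ℂ)‖ₑ = ENNReal.ofReal (2 * Real.pi) := by
    rw [← ofReal_norm, Complex.norm_real, Real.norm_of_nonneg hpi.le]
  rw [h5] at h4
  rw [mul_comm, h4]
  refine (enorm_integral_le_lintegral_enorm _).trans_eq ?_
  simp only [enorm_pow]

/-- The sub-mean value inequality for the square of the modulus of a holomorphic function, on
polydisks.  The one-variable inequality holds on each circle `c + e^{iθ} v`; one integrates over
`v`, and uses that Lebesgue measure is invariant under `v ↦ e^{iθ} v`. -/
theorem enorm_sq_mul_volume_le {f : (Fin n → ℂ) → ℂ} {U : Set (Fin n → ℂ)}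
    (hU : IsOpen U) (hf : DifferentiableOn ℂ f U) {c : Fin n → ℂ} {r : ℝ}
    (hr : closedBall c r ⊆ U) :
    ‖f c‖ₑ ^ 2 * volume (closedBall (0 : Fin n → ℂ) r) ≤ ∫⁻ z in closedBall c r, ‖f z‖ₑ ^ 2 := by
  have hpi : (0 : ℝ) < 2 * Real.pi := by positivity
  set G : (Fin n → ℂ) → ENNReal := (closedBall c r).indicator fun z => ‖f z‖ₑ ^ 2 with hG
  have hGm : Measurable G := by
    have hc : ContinuousOn (fun z => ‖f z‖ₑ ^ 2) (closedBall c r) :=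
      (ENNReal.continuous_pow 2).comp_continuousOn (hf.continuousOn.mono hr).enorm
    classical
    have := ContinuousOn.measurable_piecewise (f := fun z => ‖f z‖ₑ ^ 2)
      (g := fun _ => (0 : ENNReal))
      hc continuousOn_const isClosed_closedBall.measurableSet
    rwa [show (closedBall c r).piecewise (fun z => ‖f z‖ₑ ^ 2) (fun _ => (0 : ENNReal)) = G from
      piecewise_eq_indicator] at this
  have hmeas : Measurable fun q : (Fin n → ℂ) × ℝ => c + circleMap 0 1 q.2 • q.1 := by
    refine Continuous.measurable ?_
    have := continuous_circleMap 0 1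
    fun_prop
  have hrot : ∀ θ : ℝ, ∫⁻ v, G (c + circleMap 0 1 θ • v) = ∫⁻ v, G v := fun θ => by
    have h1 : MeasurePreserving (fun v : Fin n → ℂ => c + circleMap 0 1 θ • v) := by
      have h2 := (measurePreserving_add_left volume c).comp
        (measurePreserving_circle_smul (n := n) (Circle.exp θ))
      have h3 : circleMap 0 1 θ = (Circle.exp θ : ℂ) := by simp [circleMap]
      rw [h3]; exact h2
    exact h1.lintegral_comp hGm
  have key : ‖f c‖ₑ ^ 2 * volume (closedBall (0 : Fin n → ℂ) r) * ENNReal.ofReal (2 * Real.pi) ≤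
      (∫⁻ z in closedBall c r, ‖f z‖ₑ ^ 2) * ENNReal.ofReal (2 * Real.pi) := by
    calc _ = ∫⁻ v in closedBall (0 : Fin n → ℂ) r, ‖f c‖ₑ ^ 2 * ENNReal.ofReal (2 * Real.pi) := by
          rw [setLIntegral_const]; ring
      _ ≤ ∫⁻ v in closedBall (0 : Fin n → ℂ) r,
            ∫⁻ θ in Ioc 0 (2 * Real.pi), G (c + circleMap 0 1 θ • v) := by
          refine setLIntegral_mono' isClosed_closedBall.measurableSet fun v hv => ?_
          rw [mem_closedBall_zero_iff] at hv
          refine (enorm_sq_mul_le_lintegral_circle hU hf hr hv).trans_eq ?_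
          refine lintegral_congr fun θ => ?_
          rw [hG, indicator_of_mem]
          rw [mem_closedBall, dist_eq_norm, add_sub_cancel_left, norm_smul]
          simpa using hv
      _ ≤ ∫⁻ v, ∫⁻ θ in Ioc 0 (2 * Real.pi), G (c + circleMap 0 1 θ • v) :=
          setLIntegral_le_lintegral _ _
      _ = ∫⁻ θ in Ioc 0 (2 * Real.pi), ∫⁻ v, G (c + circleMap 0 1 θ • v) :=
          lintegral_lintegral_swap (hGm.comp hmeas).aemeasurable
      _ = ∫⁻ θ in Ioc 0 (2 * Real.pi), ∫⁻ v, G v := by simp only [hrot]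
      _ = _ := by
          rw [setLIntegral_const, hG, lintegral_indicator isClosed_closedBall.measurableSet]
          simp
  refine (ENNReal.mul_le_mul_iff_left ?_ ENNReal.ofReal_ne_top).1 key
  simpa using hpi

/-- A holomorphic function on a neighbourhood of the polydisk of radius `2` is bounded, on the
polydisk of radius `1`, by the `L²` norm of its product with `z₀ ^ k`, uniformly in `k`: by the
maximum principle in the variable `z₀`, it is enough to bound it where `|z₀| = 3 / 2`, and there
`|z₀| ≥ 1` on a polydisk of radius `1 / 2`. -/
theorem enorm_sq_mul_volume_le_lintegral_pow_mul [NeZero n] {f : (Fin n → ℂ) → ℂ}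
    {U : Set (Fin n → ℂ)} (hU : IsOpen U) (hf : DifferentiableOn ℂ f U)
    (h2 : closedBall 0 2 ⊆ U) (k : ℕ) {z : Fin n → ℂ} (hz : z ∈ closedBall 0 1) :
    ‖f z‖ₑ ^ 2 * volume (closedBall (0 : Fin n → ℂ) (1 / 2)) ≤
      ∫⁻ w in closedBall 0 2, ‖w 0 ^ k * f w‖ₑ ^ 2 := by
  have hz1 : ∀ i, ‖z i‖ ≤ 1 := by
    rw [mem_closedBall_zero_iff] at hz
    exact fun i => (norm_le_pi_norm z i).trans hz
  have hupd : ∀ a : ℂ, ‖a‖ ≤ 3 / 2 → ‖Function.update z 0 a‖ ≤ 3 / 2 := fun a ha => by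
    refine (pi_norm_le_iff_of_nonneg (by norm_num)).2 fun i => ?_
    rcases eq_or_ne i 0 with rfl | hi
    · simpa using ha
    · rw [Function.update_of_ne hi]; linarith [hz1 i]
  set I := ∫⁻ w in closedBall (0 : Fin n → ℂ) 2, ‖w 0 ^ k * f w‖ₑ ^ 2 with hI
  set v := volume (closedBall (0 : Fin n → ℂ) (1 / 2)) with hv
  have hv0 : v ≠ 0 := (measure_closedBall_pos _ _ (by norm_num)).ne'
  have hvt : v ≠ ⊤ := (isCompact_closedBall _ _).measure_lt_top.ne
  have hcirc : ∀ a ∈ sphere (0 : ℂ) (3 / 2), ‖f (Function.update z 0 a)‖ₑ ^ 2 * v ≤ I := by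
    intro a ha
    rw [mem_sphere_zero_iff_norm] at ha
    have hsub : closedBall (Function.update z 0 a) (1 / 2) ⊆ closedBall 0 2 := by
      intro w hw
      rw [mem_closedBall_zero_iff]
      rw [mem_closedBall, dist_eq_norm] at hw
      have := norm_le_norm_add_norm_sub' w (Function.update z 0 a)
      linarith [hupd a ha.le]
    refine (enorm_sq_mul_volume_le hU hf (hsub.trans h2)).trans ?_
    refine le_trans ?_ (lintegral_mono_set hsub)
    refine setLIntegral_mono' isClosed_closedBall.measurableSet fun w hw => ?_
    have hw0 : 1 ≤ ‖w 0‖ := by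
      rw [mem_closedBall, dist_eq_norm] at hw
      have h3 := (norm_le_pi_norm (w - Function.update z 0 a) 0).trans hw
      have h4 := norm_le_norm_add_norm_sub (w 0) a
      simp only [Pi.sub_apply, Function.update_self] at h3
      linarith
    have hw1 : (1 : ENNReal) ≤ ‖w 0 ^ k‖ₑ := by
      rw [enorm_pow]
      refine one_le_pow₀ ?_
      rw [← ofReal_norm]
      exact ENNReal.one_le_ofReal.2 hw0
    rw [enorm_mul]
    gcongr
    exact le_mul_of_one_le_left zero_le hw1
  rcases eq_or_ne I ⊤ with htop | htop
  · rw [htop]; exact le_top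
  set Q := (I / v).toReal with hQ
  have hIv : I / v ≠ ⊤ := (ENNReal.div_lt_top htop hv0).ne
  have hnorm : ∀ b : ℂ, ‖b‖ₑ ^ 2 * v ≤ I ↔ ‖b‖ ≤ √Q := fun b => by
    rw [← ENNReal.le_div_iff_mul_le (Or.inl hv0) (Or.inl hvt), ← ofReal_norm,
      ← ENNReal.ofReal_pow (norm_nonneg b), ENNReal.ofReal_le_iff_le_toReal hIv,
      ← Real.sqrt_le_sqrt_iff ENNReal.toReal_nonneg, Real.sqrt_sq (norm_nonneg b)]
  rw [hnorm]
  have hd : DiffContOnCl ℂ (fun a : ℂ => f (Function.update z 0 a)) (ball 0 (3 / 2)) := by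
    refine DifferentiableOn.diffContOnCl fun a ha => ?_
    rw [closure_ball _ (by norm_num), mem_closedBall_zero_iff] at ha
    have hm : Function.update z 0 a ∈ U := h2 (by
      rw [mem_closedBall_zero_iff]; linarith [hupd a ha])
    have h1 : DifferentiableAt ℂ f (Function.update z 0 a) :=
      (hf _ hm).differentiableAt (hU.mem_nhds hm)
    have h3 : DifferentiableAt ℂ (fun a : ℂ => Function.update z 0 a) a :=
      (hasFDerivAt_update z a).differentiableAt
    exact (h1.comp a h3).differentiableWithinAt
  have := Complex.norm_le_of_forall_mem_frontier_norm_le isBounded_ball hd (C := √Q) (z := z 0)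
    (fun a ha => by
      rw [frontier_ball _ (by norm_num)] at ha
      exact (hnorm _).1 (hcirc a ha))
    (by
      rw [closure_ball _ (by norm_num), mem_closedBall_zero_iff]; linarith [hz1 0])
  simpa using this

end SubMean

/-- `C` is a constant of the local `L²` estimate in the chart `φ`: a holomorphic function `u` on
the domain of `φ` is bounded, on the polydisk of radius `1`, by the `L²` norm of `z₀ ^ k * u` on
the polydisk of radius `2`, for all `k`. -/
def HermitianMetric.IsLocalEstimateConstant {n : ℕ} [NeZero n] {X : Type*}
    [TopologicalSpace X] [ChartedSpace (Fin n → ℂ) X] [MeasurableSpace X]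
    (g : HermitianMetric n X) (φ : OpenPartialHomeomorph X (Fin n → ℂ)) (C : ℝ) : Prop :=
  ∀ u : X → ℂ, IsHolomorphicOn n u φ.source → ∀ k : ℕ,
    ∀ x ∈ φ.symm '' closedBall 0 1, ‖u x‖ₑ ^ 2 ≤ ENNReal.ofReal C *
      ∫⁻ y in φ.symm '' closedBall 0 2, ‖φ y 0 ^ k * u y‖ₑ ^ 2 ∂g.vol

theorem HermitianMetric.exists_enorm_sq_le_setLIntegral {n : ℕ} [NeZero n] {X : Type*}
    [TopologicalSpace X] [ChartedSpace (Fin n → ℂ) X]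
    [IsManifold 𝓘(ℂ, Fin n → ℂ) ω X] [MeasurableSpace X] [BorelSpace X]
    (g : HermitianMetric n X) {φ : OpenPartialHomeomorph X (Fin n → ℂ)}
    (hφ : φ ∈ IsManifold.maximalAtlas 𝓘(ℂ, Fin n → ℂ) ω X) (h2 : closedBall 0 2 ⊆ φ.target) :
    ∃ C : ℝ, 1 ≤ C ∧ g.IsLocalEstimateConstant φ C := by
  obtain ⟨z₀, hz₀, hmin⟩ := (isCompact_closedBall (0 : Fin n → ℂ) 2).exists_isMinOn
    (nonempty_closedBall.2 (by norm_num)) ((g.continuousOn_det_gram hφ).mono h2)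
  set δ := (g.gram φ z₀).det.re with hδ
  have hδ0 : 0 < δ := g.det_gram_pos hφ (h2 hz₀)
  set v := volume (closedBall (0 : Fin n → ℂ) (1 / 2)) with hv
  have hv0 : v ≠ 0 := (measure_closedBall_pos _ _ (by norm_num)).ne'
  have hvt : v ≠ ⊤ := (isCompact_closedBall _ _).measure_lt_top.ne
  have hvr : 0 < v.toReal := ENNReal.toReal_pos hv0 hvt
  refine ⟨max 1 (1 / (δ * v.toReal)), le_max_left _ _, ?_⟩
  rintro u hu k _ ⟨z, hz, rfl⟩
  have hf : DifferentiableOn ℂ (u ∘ φ.symm) φ.target := by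
    have : ContMDiffOn 𝓘(ℂ, Fin n → ℂ) 𝓘(ℂ, ℂ) ω (u ∘ φ.symm) φ.target :=
      ContMDiffOn.comp hu (contMDiffOn_symm_of_mem_maximalAtlas hφ) fun z hz => φ.map_target hz
    exact (contMDiffOn_iff_contDiffOn.1 this).differentiableOn (by simp)
  have h3 := enorm_sq_mul_volume_le_lintegral_pow_mul φ.open_target hf h2 k hz
  have hF : ContinuousOn (fun y => ‖φ y 0 ^ k * u y‖ₑ ^ 2) φ.source := by
    refine (ENNReal.continuous_pow 2).comp_continuousOn (ContinuousOn.enorm ?_)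
    exact (((continuous_apply 0).comp_continuousOn φ.continuousOn).pow k).mul hu.continuousOn
  have h4 := g.mul_setLIntegral_le hφ isClosed_closedBall.measurableSet h2
    (fun z hz => hmin hz) hF
  have h5 : ∫⁻ w in closedBall (0 : Fin n → ℂ) 2, ‖w 0 ^ k * (u ∘ φ.symm) w‖ₑ ^ 2 =
      ∫⁻ w in closedBall (0 : Fin n → ℂ) 2, ‖φ (φ.symm w) 0 ^ k * u (φ.symm w)‖ₑ ^ 2 := by
    refine setLIntegral_congr_fun isClosed_closedBall.measurableSet fun w hw => ?_
    simp only [Function.comp, φ.right_inv (h2 hw)]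
  rw [h5] at h3
  set I := ∫⁻ y in φ.symm '' closedBall 0 2, ‖φ y 0 ^ k * u y‖ₑ ^ 2 ∂g.vol
  have h6 : ENNReal.ofReal (δ * v.toReal) * ‖u (φ.symm z)‖ₑ ^ 2 ≤ I := by
    rw [ENNReal.ofReal_mul hδ0.le, ENNReal.ofReal_toReal hvt, mul_assoc, mul_comm v]
    exact (mul_le_mul_right h3 _).trans h4
  have hne : ENNReal.ofReal (δ * v.toReal) ≠ 0 := by
    simpa using mul_pos hδ0 hvr
  calc ‖u (φ.symm z)‖ₑ ^ 2
      = (ENNReal.ofReal (δ * v.toReal))⁻¹ *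
          (ENNReal.ofReal (δ * v.toReal) * ‖u (φ.symm z)‖ₑ ^ 2) := by
        rw [← mul_assoc, ENNReal.inv_mul_cancel hne ENNReal.ofReal_ne_top, one_mul]
    _ ≤ (ENNReal.ofReal (δ * v.toReal))⁻¹ * I := mul_le_mul_right h6 _
    _ ≤ ENNReal.ofReal (max 1 (1 / (δ * v.toReal))) * I := by
        rw [← ENNReal.ofReal_inv_of_pos (mul_pos hδ0 hvr)]
        gcongr
        rw [← one_div]; exact le_max_right _ _

/-! ### Line bundle metrics and `L²` norms of sections -/

section LineMetric

variable {X : Type*} {L : X → Type*} [∀ x, AddCommGroup (L x)] [∀ x, Module ℂ (L x)]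

theorem LineMetric.norm_zero (h : LineMetric L) (x : X) : h.norm x 0 = 0 := by
  simpa using h.norm_smul x 0 0

theorem LineMetric.norm_nonneg (h : LineMetric L) (x : X) (v : L x) : 0 ≤ h.norm x v := by
  rcases eq_or_ne v 0 with rfl | hv
  · exact (h.norm_zero x).ge
  · exact (h.norm_pos x v hv).le

theorem LineMetric.norm_eq_exp_weight (h : LineMetric L) {e : ∀ x, L x} {x : X} (he : e x ≠ 0) :
    h.norm x (e x) = Real.exp (-h.weight e x) := by
  rw [LineMetric.weight, neg_neg, Real.exp_log (h.norm_pos x _ he)]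

end LineMetric

section Sections

variable {n : ℕ} {X : Type*} [TopologicalSpace X] [ChartedSpace (Fin n → ℂ) X]
  {L : X → Type*} [TopologicalSpace (Bundle.TotalSpace ℂ L)] [∀ x, AddCommGroup (L x)]
  [∀ x, Module ℂ (L x)] [∀ x, TopologicalSpace (L x)] [FiberBundle ℂ L] [VectorBundle ℂ ℂ L]

theorem IsFrameOn.mono {V V' : Set X} {e : ∀ x, L x} (he : IsFrameOn n L V e) (h : V' ⊆ V) :
    IsFrameOn n L V' e :=
  ⟨he.holomorphic.mono h, fun x hx => he.ne_zero x (h hx)⟩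

theorem exists_isFrameOn_baseSet [ContMDiffVectorBundle ω ℂ L 𝓘(ℂ, Fin n → ℂ)] (x₀ : X) :
    ∃ e : ∀ x, L x, IsFrameOn n L (trivializationAt ℂ L x₀).baseSet e := by
  set τ := trivializationAt ℂ L x₀
  refine ⟨fun x => τ.symm x 1, ?_, fun x hx h0 => ?_⟩
  · have h1 : ContMDiffOn 𝓘(ℂ, Fin n → ℂ) (𝓘(ℂ, Fin n → ℂ).prod 𝓘(ℂ, ℂ)) ω
        (fun x : X => (x, (1 : ℂ))) τ.baseSet := contMDiffOn_id.prodMk contMDiffOn_const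
    have h2 := (τ.contMDiffOn_symm (n := ω) (IB := 𝓘(ℂ, Fin n → ℂ))).comp h1
      fun x hx => τ.mk_mem_target.2 hx
    exact h2.congr fun x hx => τ.mk_symm hx 1
  · have h1 := τ.linearMapAt_symmₗ (R := ℂ) hx 1
    rw [τ.coe_symmₗ hx, h0, map_zero] at h1
    exact zero_ne_one h1

theorem LineMetric.tensorNormSq_nonneg (h : LineMetric L) (p : ℕ) (x : X) (T : ⨂[ℂ]^p (L x)) :
    0 ≤ h.tensorNormSq p x T := by
  rw [LineMetric.tensorNormSq, LineMetric.tensorInner, Complex.mul_conj, ← Complex.ofReal_mul,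
    Complex.ofReal_re]
  exact mul_nonneg (Complex.normSq_nonneg _) ((even_two_mul p).pow_nonneg _)

theorem LineMetric.tensorNormSq_smul_tpow (h : LineMetric L) (p : ℕ) (x : X) (a : ℂ) (v : L x) :
    h.tensorNormSq p x (a • tpow L p v) = ‖a‖ ^ 2 * h.norm x v ^ (2 * p) := by
  rw [LineMetric.tensorNormSq, h.tensorInner_smul_tpow, Complex.mul_conj, ← Complex.ofReal_mul,
    Complex.ofReal_re, Complex.normSq_eq_norm_sq]

theorem LineMetric.tensorNormSq_eq_exp (h : LineMetric L) (p : ℕ) {e : ∀ x, L x} {x : X}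
    (he : e x ≠ 0) (a : ℂ) :
    h.tensorNormSq p x (a • tpow L p (e x)) = ‖a‖ ^ 2 * Real.exp (-(2 * p * h.weight e x)) := by
  rw [h.tensorNormSq_smul_tpow, h.norm_eq_exp_weight he, ← Real.exp_nat_mul]
  congr 2; push_cast; ring

theorem LineMetric.HasLocallyBoundedWeights.exists_abs_weight_le {h : LineMetric L}
    (hh : h.HasLocallyBoundedWeights n) {V : Set X} (hV : IsOpen V) {e : ∀ x, L x}
    (he : IsFrameOn n L V e) {K : Set X} (hK : IsCompact K) (hKV : K ⊆ V) :
    ∃ C : ℝ, ∀ y ∈ K, |h.weight e y| ≤ C := by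
  refine hK.induction_on (p := fun K => ∃ C : ℝ, ∀ y ∈ K, |h.weight e y| ≤ C) ⟨0, by simp⟩ ?_ ?_ ?_
  · rintro s t hst ⟨C, hC⟩
    exact ⟨C, fun y hy => hC y (hst hy)⟩
  · rintro s t ⟨C, hC⟩ ⟨D, hD⟩
    refine ⟨max C D, fun y hy => ?_⟩
    rcases hy with hy | hy
    · exact (hC y hy).trans (le_max_left _ _)
    · exact (hD y hy).trans (le_max_right _ _)
  · intro x hx
    obtain ⟨C, hC⟩ := hh.locallyBounded V hV e he x (hKV hx)
    exact ⟨_, mem_nhdsWithin_of_mem_nhds hC, C, fun y hy => hy⟩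

variable [ContMDiffVectorBundle ω ℂ L 𝓘(ℂ, Fin n → ℂ)] {Y : Set X} {k p : ℕ}

/-- Hermitian products of holomorphic sections are locally bounded. -/
theorem exists_norm_tensorInner_le [CompactSpace X] {h : LineMetric L}
    (hh : h.HasLocallyBoundedWeights n) {S T : ∀ x, ⨂[ℂ]^p (L x)}
    (hS : S ∈ sectionsVanishing L n Y k p) (hT : T ∈ sectionsVanishing L n Y k p) :
    ∃ C : ℝ, ∀ x, ‖h.tensorInner p x (S x) (T x)‖ ≤ C := by
  suffices H : ∃ C : ℝ, ∀ x ∈ univ, ‖h.tensorInner p x (S x) (T x)‖ ≤ C by simpa using H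
  refine isCompact_univ.induction_on
    (p := fun K => ∃ C : ℝ, ∀ x ∈ K, ‖h.tensorInner p x (S x) (T x)‖ ≤ C) ⟨0, by simp⟩ ?_ ?_ ?_
  · rintro s t hst ⟨C, hC⟩
    exact ⟨C, fun y hy => hC y (hst hy)⟩
  · rintro s t ⟨C, hC⟩ ⟨D, hD⟩
    refine ⟨max C D, fun y hy => ?_⟩
    rcases hy with hy | hy
    · exact (hC y hy).trans (le_max_left _ _)
    · exact (hD y hy).trans (le_max_right _ _)
  · intro x _
    obtain ⟨e, he⟩ := exists_isFrameOn_baseSet (n := n) (L := L) x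
    set V := (trivializationAt ℂ L x).baseSet
    have hV : IsOpen V := (trivializationAt ℂ L x).open_baseSet
    have hx : x ∈ V := FiberBundle.mem_baseSet_trivializationAt' x
    obtain ⟨C, hC⟩ := hh.locallyBounded V hV e he x hx
    obtain ⟨s, hs, hsS⟩ := hS.1 V hV e he
    obtain ⟨t, ht, htT⟩ := hT.1 V hV e he
    have h1 : ∀ᶠ y in 𝓝 x, ‖s y‖ < ‖s x‖ + 1 :=
      (hs.continuousOn.continuousAt (hV.mem_nhds hx)).norm.eventually_lt_const (lt_add_one _)
    have h2 : ∀ᶠ y in 𝓝 x, ‖t y‖ < ‖t x‖ + 1 :=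
      (ht.continuousOn.continuousAt (hV.mem_nhds hx)).norm.eventually_lt_const (lt_add_one _)
    refine ⟨{y | ‖h.tensorInner p y (S y) (T y)‖ ≤
      (‖s x‖ + 1) * (‖t x‖ + 1) * Real.exp C ^ (2 * p)}, mem_nhdsWithin_of_mem_nhds ?_,
      (‖s x‖ + 1) * (‖t x‖ + 1) * Real.exp C ^ (2 * p), fun y hy => hy⟩
    filter_upwards [h1, h2, hC, hV.mem_nhds hx] with y h1 h2 hC hy
    rw [hsS y hy, htT y hy, h.tensorInner_smul_tpow, norm_mul, norm_mul,
      RCLike.norm_conj, Complex.norm_real, norm_pow, Real.norm_of_nonneg (h.norm_nonneg _ _),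
      h.norm_eq_exp_weight (he.ne_zero y hy)]
    gcongr
    exact (neg_le_abs _).trans hC

variable [IsManifold 𝓘(ℂ, Fin n → ℂ) ω X] [MeasurableSpace X] [BorelSpace X]

theorem aemeasurable_tensorInner [CompactSpace X] (g : HermitianMetric n X) {h : LineMetric L}
    (hh : h.HasLocallyBoundedWeights n) {S T : ∀ x, ⨂[ℂ]^p (L x)}
    (hS : S ∈ sectionsVanishing L n Y k p) (hT : T ∈ sectionsVanishing L n Y k p) :
    AEMeasurable (fun x => h.tensorInner p x (S x) (T x)) g.vol := by
  have key : ∀ x : X, ∃ E : Set X, E ∈ 𝓝 x ∧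
      AEMeasurable (fun x => h.tensorInner p x (S x) (T x)) (g.vol.restrict E) := by
    intro x
    obtain ⟨e, he⟩ := exists_isFrameOn_baseSet (n := n) (L := L) x
    set φ := chartAt (Fin n → ℂ) x
    have hφ : φ ∈ IsManifold.maximalAtlas 𝓘(ℂ, Fin n → ℂ) ω X := IsManifold.chart_mem_maximalAtlas x
    set E := φ.source ∩ (trivializationAt ℂ L x).baseSet with hEdef
    have hE : IsOpen E := φ.open_source.inter (trivializationAt ℂ L x).open_baseSet
    have heE := he.mono (V' := E) inter_subset_right
    obtain ⟨s, hs, hsS⟩ := hS.1 E hE e heE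
    obtain ⟨t, ht, htT⟩ := hT.1 E hE e heE
    refine ⟨E, hE.mem_nhds ⟨mem_chart_source _ x, FiberBundle.mem_baseSet_trivializationAt' x⟩,
      g.aemeasurable_of_comp_symm hφ hE.measurableSet inter_subset_left ?_⟩
    have hm : MeasurableSet (φ.target ∩ φ.symm ⁻¹' E) :=
      (φ.isOpen_inter_preimage_symm hE).measurableSet
    have hcont : ∀ {u : X → ℂ}, ContinuousOn u E →
        AEMeasurable (fun z => u (φ.symm z)) (volume.restrict (φ.target ∩ φ.symm ⁻¹' E)) :=
      fun hu => (hu.comp (φ.continuousOn_symm.mono inter_subset_left)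
        fun z hz => hz.2).aemeasurable hm
    have hw := hh.aemeasurable E hE e heE φ hφ
    have h1 : AEMeasurable (fun z => s (φ.symm z) * conj (t (φ.symm z)) *
        ((Real.exp (-h.weight e (φ.symm z)) ^ (2 * p) : ℝ) : ℂ))
        (volume.restrict (φ.target ∩ φ.symm ⁻¹' E)) :=
      ((hcont hs.continuousOn).mul
        (Complex.continuous_conj.measurable.comp_aemeasurable (hcont ht.continuousOn))).mul
        (Complex.measurable_ofReal.comp_aemeasurable
          ((Real.measurable_exp.comp_aemeasurable hw.neg).pow_const _))
    refine h1.congr ?_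
    filter_upwards [ae_restrict_mem hm] with z hz
    rw [hsS _ hz.2, htT _ hz.2, h.tensorInner_smul_tpow, h.norm_eq_exp_weight (heE.ne_zero _ hz.2)]
  choose E hE hEm using key
  obtain ⟨t, ht⟩ := CompactSpace.elim_nhds_subcover E hE
  have := (aemeasurable_iUnion_iff (μ := g.vol) (s := fun x : t => E x)
    (f := fun x => h.tensorInner p x (S x) (T x))).2 fun x => hEm x
  rwa [iUnion_subtype (p := fun x => x ∈ t) (s := fun x => E x),
    show (⋃ x, ⋃ (_ : x ∈ t), E x) = univ from ht, Measure.restrict_univ] at this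

theorem integrable_tensorInner [CompactSpace X] (g : HermitianMetric n X) {h : LineMetric L}
    (hh : h.HasLocallyBoundedWeights n) {S T : ∀ x, ⨂[ℂ]^p (L x)}
    (hS : S ∈ sectionsVanishing L n Y k p) (hT : T ∈ sectionsVanishing L n Y k p) :
    Integrable (fun x => h.tensorInner p x (S x) (T x)) g.vol := by
  have := g.isFiniteMeasure_vol
  obtain ⟨C, hC⟩ := exists_norm_tensorInner_le hh hS hT
  exact Integrable.of_bound (aemeasurable_tensorInner g hh hS hT).aestronglyMeasurable C
    (Filter.Eventually.of_forall hC)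

theorem integrable_tensorNormSq [CompactSpace X] (g : HermitianMetric n X) {h : LineMetric L}
    (hh : h.HasLocallyBoundedWeights n) {S : ∀ x, ⨂[ℂ]^p (L x)}
    (hS : S ∈ sectionsVanishing L n Y k p) :
    Integrable (fun x => h.tensorNormSq p x (S x)) g.vol :=
  (integrable_tensorInner g hh hS hS).re

theorem sectionNormSq_eq_integral [CompactSpace X] (g : HermitianMetric n X) {h : LineMetric L}
    (hh : h.HasLocallyBoundedWeights n) {S : ∀ x, ⨂[ℂ]^p (L x)}
    (hS : S ∈ sectionsVanishing L n Y k p) :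
    h.sectionNormSq g p S = ∫ x, h.tensorNormSq p x (S x) ∂g.vol :=
  (integral_re (integrable_tensorInner g hh hS hS)).symm

theorem ofReal_sectionNormSq [CompactSpace X] (g : HermitianMetric n X) {h : LineMetric L}
    (hh : h.HasLocallyBoundedWeights n) {S : ∀ x, ⨂[ℂ]^p (L x)}
    (hS : S ∈ sectionsVanishing L n Y k p) :
    ENNReal.ofReal (h.sectionNormSq g p S) =
      ∫⁻ x, ENNReal.ofReal (h.tensorNormSq p x (S x)) ∂g.vol := by
  rw [sectionNormSq_eq_integral g hh hS]
  exact ofReal_integral_eq_lintegral_ofReal (integrable_tensorNormSq g hh hS)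
    (Filter.Eventually.of_forall fun x => h.tensorNormSq_nonneg p x _)

theorem sectionNormSq_nonneg [CompactSpace X] (g : HermitianMetric n X) {h : LineMetric L}
    (hh : h.HasLocallyBoundedWeights n) {S : ∀ x, ⨂[ℂ]^p (L x)}
    (hS : S ∈ sectionsVanishing L n Y k p) : 0 ≤ h.sectionNormSq g p S := by
  rw [sectionNormSq_eq_integral g hh hS]
  exact integral_nonneg fun x => h.tensorNormSq_nonneg p x _

/-- The pointwise estimate of a section which is divisible by `z₀ ^ m` in an adapted chart. -/
theorem tensorNormSq_le_of_isLocalEstimateConstant [NeZero n] [CompactSpace X]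
    (g : HermitianMetric n X) {h : LineMetric L} (hh : h.HasLocallyBoundedWeights n)
    {φ : OpenPartialHomeomorph X (Fin n → ℂ)} (h2 : closedBall 0 2 ⊆ φ.target)
    {C : ℝ} (hC0 : 0 ≤ C) (hC : g.IsLocalEstimateConstant φ C) {e : ∀ x, L x}
    (he : IsFrameOn n L φ.source e)
    {M : ℝ} (hM : ∀ y ∈ φ.symm '' closedBall 0 2, |h.weight e y| ≤ M)
    {S : ∀ x, ⨂[ℂ]^p (L x)} (hS : S ∈ sectionsVanishing L n Y k p)
    {m : ℕ} {u : X → ℂ} (hu : IsHolomorphicOn n u φ.source)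
    (hSu : ∀ x ∈ φ.source, S x = (φ x 0 ^ m * u x) • tpow L p (e x))
    {x : X} (hx : x ∈ φ.symm '' closedBall 0 1) :
    h.tensorNormSq p x (S x) ≤
      C * ‖φ x 0‖ ^ (2 * m) * Real.exp (4 * p * M) * h.sectionNormSq g p S := by
  have hsrc : φ.symm '' closedBall 0 2 ⊆ φ.source := by
    rintro _ ⟨z, hz, rfl⟩; exact φ.map_target (h2 hz)
  have hx2 : x ∈ φ.symm '' closedBall 0 2 :=
    image_mono (closedBall_subset_closedBall (by norm_num)) hx
  have hm : MeasurableSet (φ.symm '' closedBall 0 2) := by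
    rw [φ.symm.image_eq_target_inter_inv_preimage h2]
    exact φ.continuousOn.measurableSet_inter_preimage φ.open_source.measurableSet
      isClosed_closedBall.measurableSet
  have hN := sectionNormSq_nonneg g hh hS
  -- on the polydisk, the trivialized section is bounded by the section
  have h3 : ∀ y ∈ φ.symm '' closedBall 0 2, ‖φ y 0 ^ m * u y‖ ^ 2 ≤
      Real.exp (2 * p * M) * h.tensorNormSq p y (S y) := fun y hy => by
    rw [hSu y (hsrc hy), h.tensorNormSq_eq_exp p (he.ne_zero y (hsrc hy)), mul_left_comm,
      ← Real.exp_add]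
    refine le_mul_of_one_le_right (by positivity) (Real.one_le_exp ?_)
    nlinarith [mul_le_mul_of_nonneg_left ((le_abs_self _).trans (hM y hy))
      (by positivity : (0 : ℝ) ≤ 2 * p)]
  have h4 : ENNReal.ofReal (‖u x‖ ^ 2) ≤
      ENNReal.ofReal (C * (Real.exp (2 * p * M) * h.sectionNormSq g p S)) := by
    rw [ENNReal.ofReal_pow (norm_nonneg _), ofReal_norm]
    refine (hC u hu m x hx).trans ?_
    rw [ENNReal.ofReal_mul hC0, ENNReal.ofReal_mul (Real.exp_pos _).le,
      ofReal_sectionNormSq g hh hS, ← lintegral_const_mul' (ENNReal.ofReal (Real.exp (2 * p * M))) _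
        ENNReal.ofReal_ne_top]
    refine mul_le_mul_right ?_ _
    refine le_trans ?_ (setLIntegral_le_lintegral (φ.symm '' closedBall 0 2) _)
    refine setLIntegral_mono' hm fun y hy => ?_
    rw [← ENNReal.ofReal_mul (Real.exp_pos _).le, ← ofReal_norm,
      ← ENNReal.ofReal_pow (norm_nonneg _)]
    exact ENNReal.ofReal_le_ofReal (h3 y hy)
  rw [ENNReal.ofReal_le_ofReal_iff (by positivity)] at h4
  rw [hSu x (hsrc hx2), h.tensorNormSq_eq_exp p (he.ne_zero x (hsrc hx2)), norm_mul, norm_pow,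
    mul_pow, ← pow_mul, mul_comm m 2]
  have h5 : Real.exp (-(2 * p * h.weight e x)) ≤ Real.exp (2 * p * M) := by
    refine Real.exp_le_exp.2 ?_
    nlinarith [mul_le_mul_of_nonneg_left ((neg_le_abs _).trans (hM x hx2))
      (by positivity : (0 : ℝ) ≤ 2 * p)]
  calc ‖φ x 0‖ ^ (2 * m) * ‖u x‖ ^ 2 * Real.exp (-(2 * p * h.weight e x))
      ≤ ‖φ x 0‖ ^ (2 * m) * (C * (Real.exp (2 * p * M) * h.sectionNormSq g p S)) *
          Real.exp (2 * p * M) := by gcongr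
    _ = _ := by
        rw [show (4 * p * M : ℝ) = 2 * p * M + 2 * p * M by ring, Real.exp_add]; ring

end Sections

/-! ### Rescaled charts -/

section Rescaling

variable {n : ℕ} {X : Type*} [TopologicalSpace X] [ChartedSpace (Fin n → ℂ) X]
  [IsManifold 𝓘(ℂ, Fin n → ℂ) ω X]

theorem trans_mem_maximalAtlas {ψ : OpenPartialHomeomorph X (Fin n → ℂ)}
    (hψ : ψ ∈ IsManifold.maximalAtlas 𝓘(ℂ, Fin n → ℂ) ω X)
    {θ : OpenPartialHomeomorph (Fin n → ℂ) (Fin n → ℂ)} (hθ : ContDiffOn ℂ ω θ θ.source)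
    (hθ' : ContDiffOn ℂ ω θ.symm θ.target) :
    ψ.trans θ ∈ IsManifold.maximalAtlas 𝓘(ℂ, Fin n → ℂ) ω X := by
  refine OpenPartialHomeomorph.mem_maximalAtlas_of_contMDiffOn _ ?_ ?_
  · refine (contMDiffOn_iff_contDiffOn.2 hθ).comp
      ((contMDiffOn_of_mem_maximalAtlas hψ).mono ?_) ?_
    · rw [OpenPartialHomeomorph.trans_source]; exact inter_subset_left
    · rw [OpenPartialHomeomorph.trans_source]; exact inter_subset_right
  · refine (contMDiffOn_symm_of_mem_maximalAtlas hψ).comp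
      ((contMDiffOn_iff_contDiffOn.2 hθ').mono ?_) ?_
    · rw [OpenPartialHomeomorph.trans_target]; exact inter_subset_left
    · rw [OpenPartialHomeomorph.trans_target]; exact inter_subset_right

theorem restrOpen_mem_maximalAtlas {ψ : OpenPartialHomeomorph X (Fin n → ℂ)}
    (hψ : ψ ∈ IsManifold.maximalAtlas 𝓘(ℂ, Fin n → ℂ) ω X) {V : Set X} (hV : IsOpen V) :
    ψ.restrOpen V hV ∈ IsManifold.maximalAtlas 𝓘(ℂ, Fin n → ℂ) ω X := by
  refine OpenPartialHomeomorph.mem_maximalAtlas_of_contMDiffOn _ ?_ ?_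
  · exact (contMDiffOn_of_mem_maximalAtlas hψ).mono fun x hx => hx.1
  · exact (contMDiffOn_symm_of_mem_maximalAtlas hψ).mono fun x hx => hx.1

/-- By translation, restriction and rescaling, every point is the centre of a polydisk of
radius `2` of a chart which is defined in a given open set. -/
theorem exists_chart_polydisk {ψ : OpenPartialHomeomorph X (Fin n → ℂ)}
    (hψ : ψ ∈ IsManifold.maximalAtlas 𝓘(ℂ, Fin n → ℂ) ω X) {V : Set X} (hV : IsOpen V) {x : X}
    (hx : x ∈ ψ.source) (hxV : x ∈ V) :
    ∃ φ ∈ IsManifold.maximalAtlas 𝓘(ℂ, Fin n → ℂ) ω X, ∃ r : ℝ, 0 < r ∧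
      φ.source ⊆ ψ.source ∩ V ∧ x ∈ φ.source ∧ closedBall 0 2 ⊆ φ.target ∧
      ∀ y, φ y = r⁻¹ • (ψ y - ψ x) := by
  set η := ψ.restrOpen V hV with hη
  have hηx : x ∈ η.source := ⟨hx, hxV⟩
  obtain ⟨ε, hε, hεt⟩ := nhds_basis_closedBall.mem_iff.1
    (η.open_target.mem_nhds (η.map_source hηx))
  have hr : (0 : ℝ) < ε / 2 := by positivity
  set A : (Fin n → ℂ) ≃ₜ (Fin n → ℂ) := (Homeomorph.subRight (ψ x)).trans
    (Homeomorph.smulOfNeZero ((ε / 2)⁻¹ : ℝ) (inv_ne_zero hr.ne')) with hA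
  have hA1 : ∀ w, A w = (ε / 2)⁻¹ • (w - ψ x) := fun w => rfl
  have hA2 : ∀ w, A.symm w = (ε / 2) • w + ψ x := fun w => by
    rw [Homeomorph.symm_apply_eq, hA1, add_sub_cancel_right, smul_smul, inv_mul_cancel₀ hr.ne',
      one_smul]
  refine ⟨η.trans A.toOpenPartialHomeomorph, trans_mem_maximalAtlas
    (restrOpen_mem_maximalAtlas hψ hV) ?_ ?_, ε / 2, hr, ?_, ?_, ?_, fun y => rfl⟩
  · have : ContDiff ℂ ω fun w => (ε / 2)⁻¹ • (w - ψ x) :=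
      (contDiff_id.sub contDiff_const).const_smul _
    exact this.contDiffOn
  · have : ContDiff ℂ ω fun w => (ε / 2) • w + ψ x :=
      (contDiff_id.const_smul (ε / 2)).add contDiff_const
    exact this.contDiffOn.congr fun w _ => hA2 w
  · exact fun y hy => hy.1
  · exact ⟨hηx, trivial⟩
  · intro w hw
    refine ⟨trivial, hεt ?_⟩
    have h1 : A.toOpenPartialHomeomorph.symm w = (ε / 2) • w + ψ x := hA2 w
    rw [h1, mem_closedBall, dist_eq_norm]
    rw [mem_closedBall_zero_iff] at hw
    have h2 : (ε / 2) • w + ψ x - η x = (ε / 2) • w := add_sub_cancel_right _ _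
    rw [h2, norm_smul, Real.norm_of_nonneg hr.le]
    nlinarith

end Rescaling

/-! ### Evaluation functionals on inner product spaces -/

section InnerProduct

open InnerProductSpace

variable {V : Type*} [NormedAddCommGroup V] [InnerProductSpace ℂ V]

/-- The extremal property of the Bergman kernel function: if the evaluation functional `ℓ` is
bounded, then so is the sum of the squares of its values on orthonormal vectors `v i`.  One
applies the bound to `∑ i, conj (ℓ (v i)) • v i`. -/
theorem mul_sum_norm_sq_le_of_orthonormal {d : ℕ} {v : Fin d → V} (hv : Orthonormal ℂ v)
    (l : V →ₗ[ℂ] ℂ) {w C : ℝ} (hC0 : 0 ≤ C) (hC : ∀ u, w * ‖l u‖ ^ 2 ≤ C * ‖u‖ ^ 2) :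
    w * ∑ i, ‖l (v i)‖ ^ 2 ≤ C := by
  set q := ∑ i, ‖l (v i)‖ ^ 2 with hq
  have hq0 : 0 ≤ q := Finset.sum_nonneg fun i _ => by positivity
  have h1 : l (∑ i, conj (l (v i)) • v i) = q := by
    simp only [map_sum, map_smul, smul_eq_mul, hq, Complex.ofReal_sum]
    refine Finset.sum_congr rfl fun i _ => ?_
    rw [mul_comm, Complex.mul_conj, Complex.normSq_eq_norm_sq]
  have h2 : ‖∑ i, conj (l (v i)) • v i‖ ^ 2 = q := by
    have h3 := hv.inner_sum (fun i => conj (l (v i))) (fun i => conj (l (v i))) Finset.univ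
    have h4 := inner_self_eq_norm_sq_to_K (𝕜 := ℂ) (∑ i, conj (l (v i)) • v i)
    rw [h3] at h4
    have h5 : ((‖∑ i, conj (l (v i)) • v i‖ ^ 2 : ℝ) : ℂ) = (q : ℝ) := by
      rw [Complex.ofReal_pow]
      refine h4.symm.trans ?_
      rw [hq, Complex.ofReal_sum]
      refine Finset.sum_congr rfl fun i _ => ?_
      rw [Complex.conj_conj, Complex.mul_conj, Complex.normSq_eq_norm_sq]
    exact_mod_cast h5
  have h3 := hC (∑ i, conj (l (v i)) • v i)
  rw [h1, h2, Complex.norm_real, Real.norm_of_nonneg hq0] at h3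
  rcases hq0.eq_or_lt with h0 | h0
  · rw [← h0, mul_zero]; exact hC0
  · refine le_of_mul_le_mul_right ?_ h0
    linarith [h3]

theorem norm_sq_le_of_orthonormal_basis {d : ℕ} (b : Module.Basis (Fin d) ℂ V)
    (hb : Orthonormal ℂ b) (l : V →ₗ[ℂ] ℂ) (u : V) :
    ‖l u‖ ^ 2 ≤ (∑ i, ‖l (b i)‖ ^ 2) * ‖u‖ ^ 2 := by
  set B := b.toOrthonormalBasis hb with hB
  have h1 : l u = ∑ i, inner ℂ (b i) u * l (b i) := by
    conv_lhs => rw [← B.sum_repr' u]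
    simp [hB]
  have h2 : ∑ i, ‖inner ℂ (b i) u‖ ^ 2 = ‖u‖ ^ 2 := by
    have := B.sum_sq_norm_inner_right u
    simpa [hB] using this
  have h3 : ‖l u‖ ≤ ∑ i, ‖inner ℂ (b i) u‖ * ‖l (b i)‖ := by
    rw [h1]
    refine (norm_sum_le _ _).trans_eq ?_
    simp only [norm_mul]
  calc ‖l u‖ ^ 2 ≤ (∑ i, ‖inner ℂ (b i) u‖ * ‖l (b i)‖) ^ 2 := by gcongr
    _ ≤ (∑ i, ‖inner ℂ (b i) u‖ ^ 2) * ∑ i, ‖l (b i)‖ ^ 2 := Finset.sum_mul_sq_le_sq_mul_sq _ _ _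
    _ = _ := by rw [h2, mul_comm]

theorem sum_norm_sq_eq_of_orthonormal_bases {d d' : ℕ} (b : Module.Basis (Fin d) ℂ V)
    (hb : Orthonormal ℂ b) (b' : Module.Basis (Fin d') ℂ V) (hb' : Orthonormal ℂ b')
    (l : V →ₗ[ℂ] ℂ) : ∑ i, ‖l (b i)‖ ^ 2 = ∑ i, ‖l (b' i)‖ ^ 2 := by
  refine le_antisymm ?_ ?_
  · have := mul_sum_norm_sq_le_of_orthonormal hb l (w := 1) (C := ∑ i, ‖l (b' i)‖ ^ 2)
      (by positivity) fun u => by rw [one_mul]; exact norm_sq_le_of_orthonormal_basis b' hb' l u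
    rwa [one_mul] at this
  · have := mul_sum_norm_sq_le_of_orthonormal hb' l (w := 1) (C := ∑ i, ‖l (b i)‖ ^ 2)
      (by positivity) fun u => by rw [one_mul]; exact norm_sq_le_of_orthonormal_basis b hb l u
    rwa [one_mul] at this

/-- A space of functions whose evaluations are uniformly bounded for the norm of `L²` of a finite
measure is finite dimensional: integrating the bound of `mul_sum_norm_sq_le_of_orthonormal` shows
that orthonormal families have at most `C * μ univ` members. -/
theorem finiteDimensional_of_evaluation_bound {X : Type*} [MeasurableSpace X] (μ : Measure X)
    [IsFiniteMeasure μ] (l : X → V →ₗ[ℂ] ℂ) (w : X → ℝ) {C : ℝ} (hC0 : 0 ≤ C)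
    (hC : ∀ x u, w x * ‖l x u‖ ^ 2 ≤ C * ‖u‖ ^ 2)
    (hint : ∀ u, Integrable (fun x => w x * ‖l x u‖ ^ 2) μ)
    (hnorm : ∀ u, ‖u‖ ^ 2 = ∫ x, w x * ‖l x u‖ ^ 2 ∂μ) : FiniteDimensional ℂ V := by
  by_contra hfin
  have hrank : Cardinal.aleph0 ≤ Module.rank ℂ V := by
    rw [← not_lt, Module.rank_lt_aleph0_iff]; exact hfin
  obtain ⟨N, hN⟩ := exists_nat_gt (C * μ.real univ)
  obtain ⟨s, hs, hli⟩ := exists_finset_linearIndependent_of_le_rank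
    (R := ℂ) (M := V) (n := N) ((Cardinal.natCast_lt_aleph0).le.trans hrank)
  have hli' : LinearIndependent ℂ fun i : Fin N =>
      ((s.equivFin.symm (Fin.cast hs.symm i) : s) : V) := by
    refine hli.comp (fun i : Fin N => (⟨(s.equivFin.symm (Fin.cast hs.symm i) : s).1,
      (s.equivFin.symm (Fin.cast hs.symm i) : s).2⟩ : (s : Set V))) ?_
    intro i j hij
    have h1 : (s.equivFin.symm (Fin.cast hs.symm i)) = s.equivFin.symm (Fin.cast hs.symm j) :=
      Subtype.ext (congrArg (fun a : (s : Set V) => (a : V)) hij)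
    simpa using h1
  have hv := gramSchmidtNormed_orthonormal hli'
  set v := gramSchmidtNormed ℂ fun i : Fin N => ((s.equivFin.symm (Fin.cast hs.symm i) : s) : V)
  have h1 : ∫ x, w x * ∑ i, ‖l x (v i)‖ ^ 2 ∂μ = N := by
    simp only [Finset.mul_sum]
    rw [integral_finsetSum _ fun i _ => hint (v i)]
    simp only [← hnorm, hv.1, one_pow]
    simp
  have h2 : ∫ x, w x * ∑ i, ‖l x (v i)‖ ^ 2 ∂μ ≤ ∫ _, C ∂μ := by
    refine integral_mono ?_ (integrable_const _)
      fun x => mul_sum_norm_sq_le_of_orthonormal hv (l x) hC0 (hC x)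
    simp only [Finset.mul_sum]
    exact integrable_finsetSum _ fun i _ => hint (v i)
  rw [h1, integral_const, smul_eq_mul] at h2
  linarith

end InnerProduct

/-! ### The space of sections and the partial Bergman kernel function -/

section SectionSpace

variable {n : ℕ} {X : Type*} [TopologicalSpace X] [ChartedSpace (Fin n → ℂ) X]
  {L : X → Type*} [TopologicalSpace (Bundle.TotalSpace ℂ L)] [∀ x, AddCommGroup (L x)]
  [∀ x, Module ℂ (L x)] [∀ x, TopologicalSpace (L x)] [FiberBundle ℂ L] [VectorBundle ℂ ℂ L]
  {Y : Set X} {k p : ℕ}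

theorem eq_zero_of_tensorNormSq_smul_tpow {x : X} {v : L x} {a : ℂ} (hv : v ≠ 0) (p : ℕ)
    (h : LineMetric L) (h0 : h.tensorNormSq p x (a • tpow L p v) = 0) : a = 0 := by
  rw [h.tensorNormSq_smul_tpow, mul_eq_zero] at h0
  rcases h0 with h0 | h0
  · simpa using h0
  · exact absurd h0 (pow_pos (h.norm_pos x v hv) _).ne'

/-- The evaluation of sections at `x`, in a linear coordinate of the fibre. -/
noncomputable def evalCoord (L : X → Type*) [TopologicalSpace (Bundle.TotalSpace ℂ L)]
    [∀ x, AddCommGroup (L x)] [∀ x, Module ℂ (L x)] [∀ x, TopologicalSpace (L x)]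
    [FiberBundle ℂ L] [VectorBundle ℂ ℂ L] (Y : Set X) (k p : ℕ) (x : X) :
    sectionsVanishing L n Y k p →ₗ[ℂ] ℂ :=
  (tensorCoord L p x).comp ((LinearMap.proj x).comp (sectionsVanishing L n Y k p).subtype)

theorem tensorNormSq_eq_evalCoord (h : LineMetric L) (x : X) (S : sectionsVanishing L n Y k p) :
    h.tensorNormSq p x ((S : ∀ x, ⨂[ℂ]^p (L x)) x) =
      h.norm x (fibreVector L x) ^ (2 * p) * ‖evalCoord L Y k p x S‖ ^ 2 := by
  rw [LineMetric.tensorNormSq, LineMetric.tensorInner, Complex.mul_conj, ← Complex.ofReal_mul,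
    Complex.ofReal_re, Complex.normSq_eq_norm_sq, mul_comm]
  rfl

theorem partialBergman_nonneg [MeasurableSpace X] (g : HermitianMetric n X) (h : LineMetric L) (t : ℝ)
    (x : X) : 0 ≤ partialBergman h g Y t p x := by
  rw [partialBergman]
  split_ifs
  · exact Finset.sum_nonneg fun i _ => h.tensorNormSq_nonneg p x _
  · exact le_rfl

variable [ContMDiffVectorBundle ω ℂ L 𝓘(ℂ, Fin n → ℂ)]
  [IsManifold 𝓘(ℂ, Fin n → ℂ) ω X] [MeasurableSpace X] [BorelSpace X]

/-- The values of a section are bounded by its `L²` norm, uniformly on `X`. -/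
theorem exists_tensorNormSq_le [NeZero n] [CompactSpace X] (g : HermitianMetric n X)
    {h : LineMetric L} (hh : h.HasLocallyBoundedWeights n) (Y : Set X) (k p : ℕ) :
    ∃ C : ℝ, 0 ≤ C ∧ ∀ S ∈ sectionsVanishing L n Y k p, ∀ x,
      h.tensorNormSq p x (S x) ≤ C * h.sectionNormSq g p S := by
  suffices H : ∃ C : ℝ, 0 ≤ C ∧ ∀ S ∈ sectionsVanishing L n Y k p, ∀ x ∈ univ,
      h.tensorNormSq p x (S x) ≤ C * h.sectionNormSq g p S by simpa using H
  refine isCompact_univ.induction_on (p := fun K => ∃ C : ℝ, 0 ≤ C ∧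
    ∀ S ∈ sectionsVanishing L n Y k p, ∀ x ∈ K,
      h.tensorNormSq p x (S x) ≤ C * h.sectionNormSq g p S) ⟨0, le_rfl, by simp⟩ ?_ ?_ ?_
  · rintro s t hst ⟨C, hC0, hC⟩
    exact ⟨C, hC0, fun S hS y hy => hC S hS y (hst hy)⟩
  · rintro s t ⟨C, hC0, hC⟩ ⟨D, hD0, hD⟩
    refine ⟨max C D, le_max_of_le_left hC0, fun S hS y hy => ?_⟩
    have hN := sectionNormSq_nonneg g hh hS
    rcases hy with hy | hy
    · exact (hC S hS y hy).trans (mul_le_mul_of_nonneg_right (le_max_left _ _) hN)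
    · exact (hD S hS y hy).trans (mul_le_mul_of_nonneg_right (le_max_right _ _) hN)
  · intro x _
    obtain ⟨e, he⟩ := exists_isFrameOn_baseSet (n := n) (L := L) x
    obtain ⟨φ, hφ, r, hr, hsub, hx, h2, hφeq⟩ := exists_chart_polydisk
      (IsManifold.chart_mem_maximalAtlas (I := 𝓘(ℂ, Fin n → ℂ)) (n := ω) x)
      (trivializationAt ℂ L x).open_baseSet (mem_chart_source _ x)
      (FiberBundle.mem_baseSet_trivializationAt' x)
    have heφ := he.mono (hsub.trans inter_subset_right)
    obtain ⟨C, hC1, hC⟩ := g.exists_enorm_sq_le_setLIntegral hφ h2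
    have hK : IsCompact (φ.symm '' closedBall 0 2) :=
      (isCompact_closedBall _ _).image_of_continuousOn (φ.continuousOn_symm.mono h2)
    have hKs : φ.symm '' closedBall 0 2 ⊆ φ.source := by
      rintro _ ⟨z, hz, rfl⟩; exact φ.map_target (h2 hz)
    obtain ⟨M, hM⟩ := hh.exists_abs_weight_le φ.open_source heφ hK hKs
    refine ⟨φ.symm '' ball 0 1, mem_nhdsWithin_of_mem_nhds ?_, C * Real.exp (4 * p * M),
      by positivity, fun S hS y hy => ?_⟩
    · refine (φ.symm.isOpen_image_of_subset_source isOpen_ball ?_).mem_nhds ?_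
      · exact (ball_subset_closedBall.trans (closedBall_subset_closedBall (by norm_num))).trans h2
      · refine ⟨φ x, ?_, φ.left_inv hx⟩
        rw [hφeq, sub_self, smul_zero]; exact mem_ball_self one_pos
    · obtain ⟨u, hu, huS⟩ := hS.1 _ φ.open_source e heφ
      have := tensorNormSq_le_of_isLocalEstimateConstant g hh h2 (by positivity) hC heφ hM hS (m := 0)
        hu (fun y hy => by rw [pow_zero, one_mul]; exact huS y hy)
        (image_mono ball_subset_closedBall hy)
      simpa using this

/-- The `L²` inner product on the space of holomorphic sections.  Inner products in Mathlib are
antilinear in the first argument, whence the order of the arguments.  It is definite because the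
`L²` norm bounds the pointwise norms. -/
@[reducible]
noncomputable def sectionCore [NeZero n] [CompactSpace X] (g : HermitianMetric n X)
    {h : LineMetric L} (hh : h.HasLocallyBoundedWeights n) (Y : Set X) (k p : ℕ) :
    InnerProductSpace.Core ℂ (sectionsVanishing L n Y k p) where
  inner S T := h.sectionInner g p (T : ∀ x, ⨂[ℂ]^p (L x)) (S : ∀ x, ⨂[ℂ]^p (L x))
  conj_inner_symm S T := by
    simp only [LineMetric.sectionInner]
    rw [← integral_conj]
    refine integral_congr_ae (Filter.Eventually.of_forall fun x => ?_)
    simp only [LineMetric.tensorInner, map_mul, Complex.conj_conj, Complex.conj_ofReal]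
    ring
  re_inner_nonneg S := sectionNormSq_nonneg g hh S.2
  add_left S S' T := by
    simp only [LineMetric.sectionInner]
    rw [← integral_add (integrable_tensorInner g hh T.2 S.2) (integrable_tensorInner g hh T.2 S'.2)]
    refine integral_congr_ae (Filter.Eventually.of_forall fun x => ?_)
    simp only [LineMetric.tensorInner, Submodule.coe_add, Pi.add_apply, map_add]
    ring
  smul_left S T c := by
    simp only [LineMetric.sectionInner]
    rw [← integral_const_mul]
    refine integral_congr_ae (Filter.Eventually.of_forall fun x => ?_)
    simp only [LineMetric.tensorInner, Submodule.coe_smul, Pi.smul_apply, map_smul, smul_eq_mul,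
      map_mul]
    ring
  definite S hS := by
    obtain ⟨C, -, hC⟩ := exists_tensorNormSq_le g hh Y k p
    ext x
    have h1 := hC S S.2 x
    have h2 : h.sectionNormSq g p (S : ∀ x, ⨂[ℂ]^p (L x)) = 0 := by
      rw [LineMetric.sectionNormSq, hS, Complex.zero_re]
    rw [h2, mul_zero] at h1
    have h3 := le_antisymm h1 (h.tensorNormSq_nonneg p x _)
    obtain ⟨e, he⟩ := exists_isFrameOn_baseSet (n := n) (L := L) x
    obtain ⟨s, -, hsS⟩ := S.2.1 _ (trivializationAt ℂ L x).open_baseSet e he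
    have hx := FiberBundle.mem_baseSet_trivializationAt' (F := ℂ) (E := L) x
    rw [hsS x hx] at h3
    have h4 := eq_zero_of_tensorNormSq_smul_tpow (he.ne_zero x hx) p h h3
    rw [hsS x hx, h4, zero_smul]
    rfl

/-- Finiteness of the dimension follows from the uniform bound on the values of sections, as the
volume of `X` is finite. -/
theorem finiteDimensional_sectionsVanishing [NeZero n] [CompactSpace X] (g : HermitianMetric n X)
    {h : LineMetric L} (hh : h.HasLocallyBoundedWeights n) (Y : Set X) (k p : ℕ) :
    FiniteDimensional ℂ (sectionsVanishing L n Y k p) := by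
  have := g.isFiniteMeasure_vol
  obtain ⟨C, hC0, hC⟩ := exists_tensorNormSq_le g hh Y k p
  let core := sectionCore g hh Y k p
  let _ : NormedAddCommGroup (sectionsVanishing L n Y k p) := core.toNormedAddCommGroup
  let _ : InnerProductSpace ℂ (sectionsVanishing L n Y k p) := InnerProductSpace.ofCore core.toCore
  have hnorm : ∀ S : sectionsVanishing L n Y k p,
      ‖S‖ ^ 2 = h.sectionNormSq g p (S : ∀ x, ⨂[ℂ]^p (L x)) := fun S =>
    norm_sq_eq_re_inner (𝕜 := ℂ) S
  refine finiteDimensional_of_evaluation_bound g.vol (fun x => evalCoord L Y k p x)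
    (fun x => h.norm x (fibreVector L x) ^ (2 * p)) hC0 ?_ ?_ ?_
  · intro x S
    rw [← tensorNormSq_eq_evalCoord, hnorm]
    exact hC S S.2 x
  · intro S
    simp only [← tensorNormSq_eq_evalCoord]
    exact integrable_tensorNormSq g hh S.2
  · intro S
    simp only [← tensorNormSq_eq_evalCoord]
    rw [hnorm]
    exact sectionNormSq_eq_integral g hh S.2

theorem exists_isOrthonormalSectionBasis [NeZero n] [CompactSpace X] (g : HermitianMetric n X)
    {h : LineMetric L} (hh : h.HasLocallyBoundedWeights n) (Y : Set X) (t : ℝ) (p : ℕ) :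
    ∃ b : Module.Basis (Fin (Module.finrank ℂ (partialSections n L Y t p))) ℂ
      (partialSections n L Y t p), IsOrthonormalSectionBasis h g Y t p b := by
  have hfd := finiteDimensional_sectionsVanishing g hh Y ⌊t * p⌋₊ p
  let core := sectionCore g hh Y ⌊t * p⌋₊ p
  let _ : NormedAddCommGroup (sectionsVanishing L n Y ⌊t * p⌋₊ p) := core.toNormedAddCommGroup
  let _ : InnerProductSpace ℂ (sectionsVanishing L n Y ⌊t * p⌋₊ p) :=
    InnerProductSpace.ofCore core.toCore
  let B := stdOrthonormalBasis ℂ (sectionsVanishing L n Y ⌊t * p⌋₊ p)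
  refine ⟨B.toBasis, fun i j => ?_⟩
  have h1 := orthonormal_iff_ite.1 B.orthonormal j i
  rw [OrthonormalBasis.coe_toBasis]
  refine h1.trans ?_
  simp only [eq_comm]

theorem sum_tensorNormSq_eq [NeZero n] [CompactSpace X] (g : HermitianMetric n X)
    {h : LineMetric L} (hh : h.HasLocallyBoundedWeights n) {t : ℝ} {d d' : ℕ}
    {b : Module.Basis (Fin d) ℂ (partialSections n L Y t p)}
    (hb : IsOrthonormalSectionBasis h g Y t p b)
    {b' : Module.Basis (Fin d') ℂ (partialSections n L Y t p)}
    (hb' : IsOrthonormalSectionBasis h g Y t p b') (x : X) :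
    ∑ i, h.tensorNormSq p x ((b i : ∀ x, ⨂[ℂ]^p (L x)) x) =
      ∑ i, h.tensorNormSq p x ((b' i : ∀ x, ⨂[ℂ]^p (L x)) x) := by
  let core := sectionCore g hh Y ⌊t * p⌋₊ p
  let _ : NormedAddCommGroup (sectionsVanishing L n Y ⌊t * p⌋₊ p) := core.toNormedAddCommGroup
  let _ : InnerProductSpace ℂ (sectionsVanishing L n Y ⌊t * p⌋₊ p) :=
    InnerProductSpace.ofCore core.toCore
  have ho : Orthonormal ℂ b :=
    orthonormal_iff_ite.2 fun i j => (hb j i).trans (by simp only [eq_comm])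
  have ho' : Orthonormal ℂ b' :=
    orthonormal_iff_ite.2 fun i j => (hb' j i).trans (by simp only [eq_comm])
  simp only [tensorNormSq_eq_evalCoord, ← Finset.mul_sum]
  rw [sum_norm_sq_eq_of_orthonormal_bases b ho b' ho' (evalCoord L Y ⌊t * p⌋₊ p x)]

theorem partialBergman_eq_sum [NeZero n] [CompactSpace X] (g : HermitianMetric n X)
    {h : LineMetric L} (hh : h.HasLocallyBoundedWeights n) {t : ℝ} {d : ℕ}
    {b : Module.Basis (Fin d) ℂ (partialSections n L Y t p)}
    (hb : IsOrthonormalSectionBasis h g Y t p b) (x : X) :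
    partialBergman h g Y t p x = ∑ i, h.tensorNormSq p x ((b i : ∀ x, ⨂[ℂ]^p (L x)) x) := by
  have H := exists_isOrthonormalSectionBasis g hh Y t p
  rw [partialBergman, dif_pos H]
  exact sum_tensorNormSq_eq g hh H.choose_spec hb x

theorem partialBergman_le [NeZero n] [CompactSpace X] (g : HermitianMetric n X)
    {h : LineMetric L} (hh : h.HasLocallyBoundedWeights n) {t C : ℝ} (hC0 : 0 ≤ C) {x : X}
    (hC : ∀ S ∈ partialSections n L Y t p,
      h.tensorNormSq p x (S x) ≤ C * h.sectionNormSq g p S) :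
    partialBergman h g Y t p x ≤ C := by
  obtain ⟨b, hb⟩ := exists_isOrthonormalSectionBasis g hh Y t p
  rw [partialBergman_eq_sum g hh hb x]
  let core := sectionCore g hh Y ⌊t * p⌋₊ p
  let _ : NormedAddCommGroup (sectionsVanishing L n Y ⌊t * p⌋₊ p) := core.toNormedAddCommGroup
  let _ : InnerProductSpace ℂ (sectionsVanishing L n Y ⌊t * p⌋₊ p) :=
    InnerProductSpace.ofCore core.toCore
  have ho : Orthonormal ℂ b :=
    orthonormal_iff_ite.2 fun i j => (hb j i).trans (by simp only [eq_comm])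
  have hnorm : ∀ S : sectionsVanishing L n Y ⌊t * p⌋₊ p,
      ‖S‖ ^ 2 = h.sectionNormSq g p (S : ∀ x, ⨂[ℂ]^p (L x)) := fun S =>
    norm_sq_eq_re_inner (𝕜 := ℂ) S
  simp only [tensorNormSq_eq_evalCoord, ← Finset.mul_sum]
  refine mul_sum_norm_sq_le_of_orthonormal ho _ hC0 fun S => ?_
  rw [← tensorNormSq_eq_evalCoord, hnorm]
  exact hC S S.2

end SectionSpace

/-! ### Coordinates adapted to a smooth hypersurface -/

section AdaptedCharts

variable {n : ℕ} {X : Type*} [TopologicalSpace X] [ChartedSpace (Fin n → ℂ) X] {Y : Set X}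

theorem isDefiningFunctionOn_coord [NeZero n] {φ : OpenPartialHomeomorph X (Fin n → ℂ)}
    (hφ : φ ∈ IsManifold.maximalAtlas 𝓘(ℂ, Fin n → ℂ) ω X)
    (hφY : ∀ x ∈ φ.source, x ∈ Y ↔ φ x 0 = 0) :
    IsDefiningFunctionOn n Y φ.source fun x => φ x 0 := by
  have hproj : ContMDiff 𝓘(ℂ, Fin n → ℂ) 𝓘(ℂ, ℂ) ω fun w : Fin n → ℂ => w 0 :=
    (contDiff_apply ℂ ℂ (0 : Fin n)).contMDiff
  have hhol : IsHolomorphicOn n (fun x => φ x 0) φ.source :=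
    hproj.comp_contMDiffOn (contMDiffOn_of_mem_maximalAtlas hφ)
  refine ⟨hhol, fun x hx => (hφY x hx).symm, fun x hx _ h0 => ?_⟩
  obtain ⟨z, hz, rfl⟩ : ∃ z ∈ φ.target, φ.symm z = x := ⟨φ x, φ.map_source hx, φ.left_inv hx⟩
  have hs : MDifferentiableAt 𝓘(ℂ, Fin n → ℂ) 𝓘(ℂ, Fin n → ℂ) φ.symm z :=
    (contMDiffAt_symm_of_mem_maximalAtlas hφ hz).mdifferentiableAt (by simp)
  have hf : MDifferentiableAt 𝓘(ℂ, Fin n → ℂ) 𝓘(ℂ, ℂ) (fun x => φ x 0) (φ.symm z) :=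
    (hhol.contMDiffAt (φ.open_source.mem_nhds hx)).mdifferentiableAt (by simp)
  have h2 := mfderiv_comp z hf hs
  have heq : (fun x => φ x 0) ∘ φ.symm =ᶠ[𝓝 z] fun w => w 0 := by
    filter_upwards [φ.open_target.mem_nhds hz] with w hw
    simp [φ.right_inv hw]
  rw [h0, ContinuousLinearMap.zero_comp, heq.mfderiv_eq] at h2
  have h3 : fderiv ℂ (fun w : Fin n → ℂ => w 0) z = 0 := by
    rw [← mfderiv_eq_fderiv]; exact h2
  have h4 : fderiv ℂ (fun w : Fin n → ℂ => w 0) z = ContinuousLinearMap.proj 0 :=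
    (ContinuousLinearMap.proj (R := ℂ) (φ := fun _ : Fin n => ℂ) 0).fderiv
  rw [h4] at h3
  have := congrArg (fun A : (Fin n → ℂ) →L[ℂ] ℂ => A (Pi.single 0 1)) h3
  simp at this

/-- In coordinates, a defining function has a nonzero differential along the hypersurface. -/
theorem IsDefiningFunctionOn.fderiv_comp_symm_ne_zero {V : Set X} (hV : IsOpen V) {f : X → ℂ}
    (hf : IsDefiningFunctionOn n Y V f) {φ : OpenPartialHomeomorph X (Fin n → ℂ)}
    (hφ : φ ∈ IsManifold.maximalAtlas 𝓘(ℂ, Fin n → ℂ) ω X) {x : X} (hx : x ∈ φ.source)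
    (hxV : x ∈ V) (hxY : x ∈ Y) : fderiv ℂ (f ∘ φ.symm) (φ x) ≠ 0 := by
  intro h0
  have hfx : MDifferentiableAt 𝓘(ℂ, Fin n → ℂ) 𝓘(ℂ, ℂ) (f ∘ φ.symm) (φ x) := by
    have h1 : ContMDiffAt 𝓘(ℂ, Fin n → ℂ) 𝓘(ℂ, ℂ) ω f (φ.symm (φ x)) := by
      rw [φ.left_inv hx]; exact hf.holomorphic.contMDiffAt (hV.mem_nhds hxV)
    exact (h1.comp (φ x) (contMDiffAt_symm_of_mem_maximalAtlas hφ (φ.map_source hx))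
      ).mdifferentiableAt (by simp)
  have hφx : MDifferentiableAt 𝓘(ℂ, Fin n → ℂ) 𝓘(ℂ, Fin n → ℂ) φ x :=
    (contMDiffAt_of_mem_maximalAtlas hφ hx).mdifferentiableAt (by simp)
  have h2 := mfderiv_comp x hfx hφx
  have heq : (f ∘ φ.symm) ∘ φ =ᶠ[𝓝 x] f := by
    filter_upwards [φ.open_source.mem_nhds hx] with y hy
    simp [φ.left_inv hy]
  rw [heq.mfderiv_eq, mfderiv_eq_fderiv, h0] at h2
  exact hf.mfderiv_ne_zero x hxV hxY (h2.trans (ContinuousLinearMap.zero_comp _))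

theorem IsHolomorphicOn.contDiffAt_comp_symm {V : Set X} {f : X → ℂ}
    (hf : IsHolomorphicOn n f V) (hV : IsOpen V) {φ : OpenPartialHomeomorph X (Fin n → ℂ)}
    (hφ : φ ∈ IsManifold.maximalAtlas 𝓘(ℂ, Fin n → ℂ) ω X) {x : X} (hx : x ∈ φ.source)
    (hxV : x ∈ V) : ContDiffAt ℂ ω (f ∘ φ.symm) (φ x) := by
  have h1 : ContMDiffAt 𝓘(ℂ, Fin n → ℂ) 𝓘(ℂ, ℂ) ω f (φ.symm (φ x)) := by
    rw [φ.left_inv hx]; exact hf.contMDiffAt (hV.mem_nhds hxV)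
  exact contMDiffAt_iff_contDiffAt.1
    (h1.comp (φ x) (contMDiffAt_symm_of_mem_maximalAtlas hφ (φ.map_source hx)))

variable [NeZero n]

/-- A holomorphic function with nonzero differential is the first coordinate of a local
biholomorphism: complete it with all the coordinates but one. -/
theorem exists_biholomorphism_of_fderiv_ne_zero {F : (Fin n → ℂ) → ℂ} {c : Fin n → ℂ}
    (hF : ContDiffAt ℂ ω F c) (hF' : fderiv ℂ F c ≠ 0) :
    ∃ θ : OpenPartialHomeomorph (Fin n → ℂ) (Fin n → ℂ), c ∈ θ.source ∧
      ContDiffOn ℂ ω θ θ.source ∧ ContDiffOn ℂ ω θ.symm θ.target ∧ ∀ w, θ w 0 = F w := by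
  obtain ⟨i, hi⟩ : ∃ i, fderiv ℂ F c (Pi.single i 1) ≠ 0 := by
    by_contra! H
    refine hF' (ContinuousLinearMap.ext fun v => ?_)
    conv_lhs => rw [vec_eq_sum_single v, map_sum]
    simp [H]
  set σ : Equiv.Perm (Fin n) := Equiv.swap 0 i
  set Φ : (Fin n → ℂ) → (Fin n → ℂ) := fun w j => if j = 0 then F w else w (σ j) with hΦ
  have hΦc : ContDiffAt ℂ ω Φ c := by
    refine contDiffAt_pi.2 fun j => ?_
    by_cases hj : j = 0
    · simpa [hΦ, hj] using hF
    · simpa [hΦ, hj] using (contDiff_apply ℂ ℂ (σ j)).contDiffAt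
  have hΦ' := (hΦc.differentiableAt (by simp)).hasFDerivAt
  set D := fderiv ℂ Φ c with hD
  have hDj : ∀ v j, D v j = if j = 0 then fderiv ℂ F c v else v (σ j) := by
    intro v j
    have h1 := (hasFDerivAt_pi'.1 hΦ') j
    by_cases hj : j = 0
    · have h2 : HasFDerivAt (fun w => Φ w j) (fderiv ℂ F c) c := by
        simpa [hΦ, hj] using (hF.differentiableAt (by simp)).hasFDerivAt
      have := congrArg (fun A : (Fin n → ℂ) →L[ℂ] ℂ => A v) (h1.unique h2)
      simpa [hj] using this
    · have h2 : HasFDerivAt (fun w => Φ w j)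
          (ContinuousLinearMap.proj (R := ℂ) (φ := fun _ : Fin n => ℂ) (σ j)) c := by
        simp only [hΦ, if_neg hj]
        exact (ContinuousLinearMap.proj (R := ℂ) (φ := fun _ : Fin n => ℂ) (σ j)).hasFDerivAt
      have := congrArg (fun A : (Fin n → ℂ) →L[ℂ] ℂ => A v) (h1.unique h2)
      simpa [hj] using this
  have hinj : Function.Injective (D : (Fin n → ℂ) →ₗ[ℂ] (Fin n → ℂ)) := by
    rw [← LinearMap.ker_eq_bot, LinearMap.ker_eq_bot']
    intro v hv
    have hv' : ∀ j, D v j = 0 := fun j => congrFun hv j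
    have hoff : ∀ m, m ≠ i → v m = 0 := by
      intro m hm
      have h1 := hv' (σ m)
      have h2 : σ m ≠ 0 := by
        intro h
        have : m = σ 0 := by rw [← h]; simp [σ]
        exact hm (by simpa [σ] using this)
      rw [hDj, if_neg h2] at h1
      simpa [σ] using h1
    have hvi : v = v i • (Pi.single i 1 : Fin n → ℂ) := by
      ext m
      by_cases hm : m = i
      · subst hm; simp
      · simp [hoff m hm, hm]
    have h0 := hv' 0
    rw [hDj, if_pos rfl, hvi, map_smul, smul_eq_mul, mul_eq_zero] at h0
    have : v i = 0 := h0.resolve_right hi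
    rw [hvi, this, zero_smul]
  set E : (Fin n → ℂ) ≃L[ℂ] (Fin n → ℂ) :=
    (LinearEquiv.ofInjectiveEndo (D : (Fin n → ℂ) →ₗ[ℂ] (Fin n → ℂ)) hinj).toContinuousLinearEquiv
  have hE : HasFDerivAt Φ (E : (Fin n → ℂ) →L[ℂ] (Fin n → ℂ)) c := by
    have : (E : (Fin n → ℂ) →L[ℂ] (Fin n → ℂ)) = D := by ext v; rfl
    rw [this]; exact hΦ'
  set θ₀ := hΦc.toOpenPartialHomeomorph Φ hE (by simp) with hθ₀
  have hc : c ∈ θ₀.source := hΦc.mem_toOpenPartialHomeomorph_source hE (by simp)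
  have hcoe : ⇑θ₀ = Φ := hΦc.toOpenPartialHomeomorph_coe hE (by simp)
  have hsymm : ContDiffAt ℂ ω θ₀.symm (θ₀ c) := by
    refine θ₀.contDiffAt_symm (f₀' := E) (θ₀.map_source hc) ?_ ?_
    · rw [θ₀.left_inv hc, hcoe]; exact hE
    · rw [θ₀.left_inv hc, hcoe]; exact hΦc
  obtain ⟨O₁, hO₁, hO₁o, hcO₁⟩ := _root_.eventually_nhds_iff.1 (hΦc.eventually (by simp))
  obtain ⟨O₂, hO₂, hO₂o, hcO₂⟩ := _root_.eventually_nhds_iff.1 (hsymm.eventually (by simp))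
  have hO : IsOpen (O₁ ∩ (θ₀.source ∩ θ₀ ⁻¹' O₂)) := hO₁o.inter (θ₀.isOpen_inter_preimage hO₂o)
  refine ⟨θ₀.restrOpen _ hO, ⟨hc, hcO₁, hc, hcO₂⟩, ?_, ?_, fun w => ?_⟩
  · intro w hw
    have : ContDiffAt ℂ ω θ₀ w := by rw [hcoe]; exact hO₁ w hw.2.1
    exact this.contDiffWithinAt
  · intro w hw
    have h1 : θ₀ (θ₀.symm w) ∈ O₂ := hw.2.2.2
    rw [θ₀.right_inv hw.1] at h1
    exact (hO₂ w h1).contDiffWithinAt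
  · have : (θ₀.restrOpen _ hO) w = Φ w := by rw [← hcoe]; rfl
    rw [this]; simp [hΦ]

/-- Near each of its points, a smooth hypersurface is `{z₀ = 0}` in suitable coordinates. -/
theorem IsSmoothHypersurface.exists_adapted_chart [IsManifold 𝓘(ℂ, Fin n → ℂ) ω X]
    (hY : IsSmoothHypersurface n Y) {y : X}
    (hy : y ∈ Y) {V : Set X} (hV : IsOpen V) (hyV : y ∈ V) :
    ∃ φ ∈ IsManifold.maximalAtlas 𝓘(ℂ, Fin n → ℂ) ω X, φ.source ⊆ V ∧ y ∈ φ.source ∧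
      closedBall 0 2 ⊆ φ.target ∧ φ y = 0 ∧ ∀ x ∈ φ.source, x ∈ Y ↔ φ x 0 = 0 := by
  obtain ⟨V', hV', hyV', f, hf⟩ := hY.exists_definingFunction y hy
  set ψ := chartAt (Fin n → ℂ) y
  have hψ : ψ ∈ IsManifold.maximalAtlas 𝓘(ℂ, Fin n → ℂ) ω X := IsManifold.chart_mem_maximalAtlas y
  have hyψ : y ∈ ψ.source := mem_chart_source _ y
  obtain ⟨θ, hcθ, hθ, hθ', hθ0⟩ := exists_biholomorphism_of_fderiv_ne_zero
    (hf.holomorphic.contDiffAt_comp_symm hV' hψ hyψ hyV')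
    (hf.fderiv_comp_symm_ne_zero hV' hψ hyψ hyV' hy)
  obtain ⟨φ, hφ, r, hr, hsub, hyφ, h2, hφeq⟩ := exists_chart_polydisk
    (trans_mem_maximalAtlas hψ hθ hθ') (hV.inter hV') (x := y)
    (by rw [OpenPartialHomeomorph.trans_source]; exact ⟨hyψ, hcθ⟩) ⟨hyV, hyV'⟩
  have hcoord : ∀ x ∈ ψ.source, (ψ.trans θ) x 0 = f x := fun x hx => by
    rw [OpenPartialHomeomorph.coe_trans, Function.comp, hθ0, Function.comp, ψ.left_inv hx]
  refine ⟨φ, hφ, fun x hx => (hsub hx).2.1, hyφ, h2, ?_, fun x hx => ?_⟩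
  · rw [hφeq, sub_self, smul_zero]
  · have hxs : x ∈ (ψ.trans θ).source := (hsub hx).1
    rw [OpenPartialHomeomorph.trans_source] at hxs
    have : φ x 0 = r⁻¹ • f x := by
      rw [hφeq, Pi.smul_apply, Pi.sub_apply, hcoord x hxs.1, hcoord y hyψ,
        (hf.zero_iff y hyV').2 hy, sub_zero]
    rw [this, smul_eq_zero_iff_right (inv_ne_zero hr.ne'), hf.zero_iff x (hsub hx).2.2]

/-- A defining function of `Y` vanishes to first order only, hence bounds the coordinate `z₀` of
an adapted chart: since its differential is nonzero and kills the vectors tangent to `{z₀ = 0}`,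
its derivative in the direction of `z₀` is nonzero. -/
theorem IsDefiningFunctionOn.exists_norm_coord_le {V : Set X} (hV : IsOpen V) {f : X → ℂ}
    (hf : IsDefiningFunctionOn n Y V f) {φ : OpenPartialHomeomorph X (Fin n → ℂ)}
    (hφ : φ ∈ IsManifold.maximalAtlas 𝓘(ℂ, Fin n → ℂ) ω X)
    (hφY : ∀ x ∈ φ.source, x ∈ Y ↔ φ x 0 = 0) {x : X} (hx : x ∈ φ.source)
    (hxV : x ∈ V) (hxY : x ∈ Y) : ∃ B : ℝ, 0 ≤ B ∧ ∀ᶠ y in 𝓝 x, ‖φ y 0‖ ≤ B * ‖f y‖ := by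
  set F := f ∘ φ.symm with hFdef
  set c := φ x with hc
  have hcd := hf.holomorphic.contDiffAt_comp_symm hV hφ hx hxV
  have hstrict : HasStrictFDerivAt F (fderiv ℂ F c) c := hcd.hasStrictFDerivAt (by simp)
  set D := fderiv ℂ F c with hD
  have hc0 : c 0 = 0 := (hφY x hx).1 hxY
  have hΩ : ∀ᶠ w in 𝓝 c, w 0 = 0 → F w = 0 := by
    have hO : IsOpen (φ.target ∩ φ.symm ⁻¹' V) := φ.isOpen_inter_preimage_symm hV
    have hcO : c ∈ φ.target ∩ φ.symm ⁻¹' V :=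
      ⟨φ.map_source hx, by rw [mem_preimage, hc, φ.left_inv hx]; exact hxV⟩
    filter_upwards [hO.mem_nhds hcO] with w hw hw0
    refine (hf.zero_iff _ hw.2).2 ((hφY _ (φ.map_target hw.1)).2 ?_)
    rw [φ.right_inv hw.1]; exact hw0
  have hker : ∀ v : Fin n → ℂ, v 0 = 0 → D v = 0 := by
    intro v hv
    have h1 : HasLineDerivAt ℂ F (D v) c v := hstrict.hasFDerivAt.hasLineDerivAt v
    have h2 : Filter.Tendsto (fun τ : ℂ => c + τ • v) (𝓝 0) (𝓝 c) := by
      have : Continuous fun τ : ℂ => c + τ • v := by fun_prop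
      simpa using this.tendsto 0
    have h3 : (fun τ : ℂ => F (c + τ • v)) =ᶠ[𝓝 0] fun _ => 0 := by
      filter_upwards [h2.eventually hΩ] with τ hτ
      exact hτ (by simp [hc0, hv])
    have h4 : HasDerivAt (fun τ : ℂ => F (c + τ • v)) 0 0 :=
      (hasDerivAt_const (0 : ℂ) (0 : ℂ)).congr_of_eventuallyEq h3
    exact HasDerivAt.unique h1 h4
  have hα : D (Pi.single 0 1) ≠ 0 := by
    intro h0
    refine hf.fderiv_comp_symm_ne_zero hV hφ hx hxV hxY (ContinuousLinearMap.ext fun v => ?_)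
    have h1 : v = v 0 • (Pi.single 0 1 : Fin n → ℂ) + (v - v 0 • Pi.single 0 1) := by abel
    have h2 : D (v - v 0 • Pi.single 0 1) = 0 := hker _ (by simp)
    change D v = 0
    rw [h1, map_add, map_smul, h0, h2]; simp
  set α := ‖D (Pi.single 0 1)‖ with hαdef
  have hα0 : 0 < α := norm_pos_iff.2 hα
  have hlittle := hstrict.isLittleO.def (half_pos hα0)
  have hpair : Filter.Tendsto (fun w : Fin n → ℂ => (w, Function.update w 0 0)) (𝓝 c)
      (𝓝 (c, c)) := by
    have h1 : Continuous fun w : Fin n → ℂ => (w, Function.update w 0 (0 : ℂ)) :=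
      continuous_id.prodMk (continuous_id.update 0 continuous_const)
    have h2 : Function.update c 0 (0 : ℂ) = c := by
      rw [← hc0]; exact Function.update_eq_self 0 c
    simpa [h2] using h1.tendsto c
  have hupd : Filter.Tendsto (fun w : Fin n → ℂ => Function.update w 0 (0 : ℂ)) (𝓝 c) (𝓝 c) :=
    (continuous_snd.tendsto (c, c)).comp hpair
  have hw : ∀ᶠ w in 𝓝 c, ‖w 0‖ ≤ 2 / α * ‖F w‖ := by
    filter_upwards [hpair.eventually hlittle, hupd.eventually hΩ] with w h1 h2
    have h3 : w - Function.update w 0 0 = w 0 • (Pi.single 0 1 : Fin n → ℂ) := by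
      ext j
      by_cases hj : j = 0
      · subst hj; simp
      · simp [hj]
    have h4 : ‖w - Function.update w 0 0‖ = ‖w 0‖ := by
      rw [h3, norm_smul, Pi.norm_single]; simp
    simp only [h2 (by simp), sub_zero] at h1
    rw [h4, h3, map_smul, smul_eq_mul] at h1
    have h5 := norm_sub_norm_le (w 0 * D (Pi.single 0 1)) (F w)
    rw [norm_mul, norm_sub_rev] at h5
    rw [div_mul_eq_mul_div, le_div_iff₀ hα0]
    linarith
  refine ⟨2 / α, by positivity, ?_⟩
  have hφc : Filter.Tendsto φ (𝓝 x) (𝓝 c) := φ.continuousAt hx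
  filter_upwards [hφc.eventually hw, φ.open_source.mem_nhds hx] with y hy hys
  rwa [hFdef, Function.comp, φ.left_inv hys] at hy

end AdaptedCharts

/-! ### Exponential decay and `O(p^{-∞})` -/

section Asymptotics

/-- Exponential decay for large `p`, locally uniformly, and local bounds for small `p` give
`O(p^{-∞})`. -/
theorem isBigOInfty_of_le_pow {X : Type*} [TopologicalSpace X] {f : ℕ → X → ℝ} {M : Set X} {N : ℝ}
    (hf : ∀ p, ∀ x ∈ M, 0 ≤ f p x)
    (hsmall : ∀ K ⊆ M, IsCompact K → ∃ B : ℝ, ∀ p : ℕ, 1 ≤ p → (p : ℝ) ≤ N → ∀ x ∈ K, f p x ≤ B)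
    (hlarge : ∀ K ⊆ M, IsCompact K → ∃ a : ℝ, 0 ≤ a ∧ a < 1 ∧
      ∀ p : ℕ, N < p → ∀ x ∈ K, f p x ≤ a ^ p) : IsBigOInfty f M := by
  intro K hKM hK l
  obtain ⟨B, hB⟩ := hsmall K hKM hK
  obtain ⟨a, ha0, ha1, ha⟩ := hlarge K hKM hK
  obtain ⟨D, hD⟩ := (tendsto_pow_const_mul_const_pow_of_abs_lt_one l
    (by rwa [abs_of_nonneg ha0])).bddAbove_range
  refine ⟨|B| * |N| ^ l + |D| + 1, by positivity, fun p hp x hx => ?_⟩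
  have hp0 : (0 : ℝ) < (p : ℝ) ^ l := by positivity
  rw [abs_of_nonneg (hf p x (hKM hx)), ← div_eq_mul_inv, le_div_iff₀ hp0]
  rcases le_or_gt (p : ℝ) N with hpN | hpN
  · have h1 : f p x * (p : ℝ) ^ l ≤ |B| * |N| ^ l := by
      refine mul_le_mul ((hB p hp hpN x hx).trans (le_abs_self B)) ?_ hp0.le (abs_nonneg B)
      exact pow_le_pow_left₀ (Nat.cast_nonneg p) (hpN.trans (le_abs_self N)) l
    have := abs_nonneg D
    linarith
  · have h1 : f p x * (p : ℝ) ^ l ≤ (p : ℝ) ^ l * a ^ p := by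
      rw [mul_comm]; exact mul_le_mul_of_nonneg_left (ha p hpN x hx) hp0.le
    have h2 : (p : ℝ) ^ l * a ^ p ≤ D := hD (mem_range_self p)
    have h3 : 0 ≤ |B| * |N| ^ l := by positivity
    have := le_abs_self D
    linarith

/-- For `p > 2 / t` one has `⌊t p⌋ ≥ t p - 1 ≥ t p / 2`. -/
theorem pow_floor_mul_exp_le {q t M : ℝ} (hq0 : 0 ≤ q) (hq1 : q ≤ 1) (ht : 0 < t) {p : ℕ}
    (hp : 2 / t < p) :
    q ^ (2 * ⌊t * p⌋₊) * Real.exp (4 * p * M) ≤ (q ^ t * Real.exp (4 * M)) ^ p := by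
  have htp : 2 < t * p := by rwa [div_lt_iff₀' ht] at hp
  have h1 : t * p ≤ (2 * ⌊t * p⌋₊ : ℕ) := by
    have := Nat.lt_floor_add_one (t * p)
    push_cast
    linarith
  rw [mul_pow, ← Real.exp_nat_mul, ← Real.rpow_mul_natCast hq0,
    show (p : ℝ) * (4 * M) = 4 * p * M by ring]
  refine mul_le_mul_of_nonneg_right ?_ (Real.exp_pos _).le
  rw [← Real.rpow_natCast]
  exact Real.rpow_le_rpow_of_exponent_ge_of_imp hq0 hq1 h1 fun _ h => by linarith

theorem one_le_floor_mul {t : ℝ} {p : ℕ} (ht : 0 < t) (hp : 2 / t < p) : 1 ≤ ⌊t * p⌋₊ := by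
  have htp : 2 < t * p := by rwa [div_lt_iff₀' ht] at hp
  exact Nat.le_floor (by push_cast; linarith)

end Asymptotics

/-! ### Decay near the hypersurface -/

section Decay

variable {n : ℕ} [NeZero n] {X : Type*} [TopologicalSpace X] [ChartedSpace (Fin n → ℂ) X]
  [IsManifold 𝓘(ℂ, Fin n → ℂ) ω X] {Y : Set X}
  {L : X → Type*} [TopologicalSpace (Bundle.TotalSpace ℂ L)] [∀ x, AddCommGroup (L x)]
  [∀ x, Module ℂ (L x)] [∀ x, TopologicalSpace (L x)] [FiberBundle ℂ L] [VectorBundle ℂ ℂ L]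
  [CompactSpace X] [MeasurableSpace X] [BorelSpace X]
  [ContMDiffVectorBundle ω ℂ L 𝓘(ℂ, Fin n → ℂ)]

/-- The pointwise estimate, in an adapted chart, of the sections which vanish along `Y`. -/
theorem tensorNormSq_le_of_adapted (g : HermitianMetric n X)
    {h : LineMetric L} (hh : h.HasLocallyBoundedWeights n)
    {φ : OpenPartialHomeomorph X (Fin n → ℂ)}
    (hφ : φ ∈ IsManifold.maximalAtlas 𝓘(ℂ, Fin n → ℂ) ω X) (h2 : closedBall 0 2 ⊆ φ.target)
    (hφY : ∀ x ∈ φ.source, x ∈ Y ↔ φ x 0 = 0)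
    {C : ℝ} (hC0 : 0 ≤ C) (hC : g.IsLocalEstimateConstant φ C) {e : ∀ x, L x}
    (he : IsFrameOn n L φ.source e)
    {M : ℝ} (hM : ∀ y ∈ φ.symm '' closedBall 0 2, |h.weight e y| ≤ M) {k p : ℕ}
    {S : ∀ x, ⨂[ℂ]^p (L x)} (hS : S ∈ sectionsVanishing L n Y k p)
    {x : X} (hx : x ∈ φ.symm '' closedBall 0 1) :
    h.tensorNormSq p x (S x) ≤
      C * ‖φ x 0‖ ^ (2 * k) * Real.exp (4 * p * M) * h.sectionNormSq g p S := by
  obtain ⟨u, hu, huS⟩ := hS.2 _ φ.open_source e he _ (isDefiningFunctionOn_coord hφ hφY)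
  exact tensorNormSq_le_of_isLocalEstimateConstant g hh h2 hC0 hC he hM hS hu huS hx

/-- Near each point of `Y`, the partial Bergman kernel functions decay at least like `2 ^ (-p)`. -/
theorem exists_partialBergman_le_half_pow (g : HermitianMetric n X)
    (hY : IsSmoothHypersurface n Y) {h : LineMetric L} (hh : h.HasLocallyBoundedWeights n)
    {t : ℝ} (ht : 0 < t) {y : X} (hy : y ∈ Y) :
    ∃ U : Set X, IsOpen U ∧ y ∈ U ∧ ∀ p : ℕ, 2 / t < p → ∀ x ∈ U,
      partialBergman h g Y t p x ≤ (1 / 2) ^ p := by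
  obtain ⟨e, he⟩ := exists_isFrameOn_baseSet (n := n) (L := L) y
  obtain ⟨φ, hφ, hsub, hyφ, h2, hφy, hφY⟩ := hY.exists_adapted_chart hy
    (trivializationAt ℂ L y).open_baseSet (FiberBundle.mem_baseSet_trivializationAt' y)
  have heφ := he.mono hsub
  obtain ⟨C, hC1, hC⟩ := g.exists_enorm_sq_le_setLIntegral hφ h2
  have hK : IsCompact (φ.symm '' closedBall 0 2) :=
    (isCompact_closedBall _ _).image_of_continuousOn (φ.continuousOn_symm.mono h2)
  have hKs : φ.symm '' closedBall 0 2 ⊆ φ.source := by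
    rintro _ ⟨z, hz, rfl⟩; exact φ.map_target (h2 hz)
  obtain ⟨M₀, hM₀⟩ := hh.exists_abs_weight_le φ.open_source heφ hK hKs
  set M := max M₀ 0
  have hM : ∀ y ∈ φ.symm '' closedBall 0 2, |h.weight e y| ≤ M :=
    fun y hy => (hM₀ y hy).trans (le_max_left _ _)
  -- the bound `q` of `C |z₀|` is such that `q ^ t * exp (4 * M) = 1 / 2`
  set q := (Real.exp (-(4 * M)) / 2) ^ t⁻¹ with hq
  have hbase : Real.exp (-(4 * M)) / 2 ≤ 1 := by
    have : Real.exp (-(4 * M)) ≤ 1 := Real.exp_le_one_iff.2 (by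
      have := le_max_right M₀ 0; linarith)
    linarith
  have hq0 : 0 < q := Real.rpow_pos_of_pos (by positivity) _
  have hq1 : q ≤ 1 := Real.rpow_le_one (by positivity) hbase (by positivity)
  have hqt : q ^ t * Real.exp (4 * M) = 1 / 2 := by
    rw [hq, Real.rpow_inv_rpow (by positivity) ht.ne', Real.exp_neg]
    field_simp
  have hopen : IsOpen (ball (0 : Fin n → ℂ) 1 ∩ {z | C * ‖z 0‖ < q}) := by
    refine isOpen_ball.inter (isOpen_lt ?_ continuous_const)
    fun_prop
  refine ⟨φ.symm '' (ball 0 1 ∩ {z | C * ‖z 0‖ < q}),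
    φ.symm.isOpen_image_of_subset_source hopen ?_, ⟨φ y, ⟨?_, ?_⟩, φ.left_inv hyφ⟩, ?_⟩
  · exact inter_subset_left.trans ((ball_subset_closedBall.trans
      (closedBall_subset_closedBall (by norm_num))).trans h2)
  · rw [hφy]; exact mem_ball_self one_pos
  · rw [hφy]; simpa using hq0
  · rintro p hp _ ⟨z, ⟨hz1, hz2⟩, rfl⟩
    have hφz : φ (φ.symm z) = z := φ.right_inv (h2 (ball_subset_closedBall
      (ball_subset_ball (by norm_num) hz1)))
    have hk := one_le_floor_mul ht hp
    have h3 : C * ‖z 0‖ ^ (2 * ⌊t * p⌋₊) ≤ q ^ (2 * ⌊t * p⌋₊) := by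
      calc C * ‖z 0‖ ^ (2 * ⌊t * p⌋₊) ≤ C ^ (2 * ⌊t * p⌋₊) * ‖z 0‖ ^ (2 * ⌊t * p⌋₊) := by
            gcongr
            exact le_self_pow₀ hC1 (by omega)
        _ = (C * ‖z 0‖) ^ (2 * ⌊t * p⌋₊) := (mul_pow _ _ _).symm
        _ ≤ _ := pow_le_pow_left₀ (by positivity) (le_of_lt hz2) _
    have h4 := pow_floor_mul_exp_le (M := M) hq0.le hq1 ht hp
    rw [hqt] at h4
    refine le_trans ?_ h4
    refine partialBergman_le g hh (by positivity) fun S hS => ?_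
    refine (tensorNormSq_le_of_adapted g hh hφ h2 hφY (by positivity) hC heφ hM hS
      (mem_image_of_mem _ (ball_subset_closedBall hz1))).trans ?_
    rw [hφz]
    exact mul_le_mul_of_nonneg_right (mul_le_mul_of_nonneg_right h3 (Real.exp_pos _).le)
      (sectionNormSq_nonneg g hh hS)

/-- The rate `1 / 2` is the same at all points of `Y`, so that a union of neighbourhoods of the
points is a neighbourhood of `Y` with the required properties. -/
theorem exists_isOpen_partialBergman_decay (g : HermitianMetric n X)
    (hY : IsSmoothHypersurface n Y) {h : LineMetric L} (hh : h.HasLocallyBoundedWeights n)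
    {t : ℝ} (ht : 0 < t) :
    ∃ (U : Set X) (a : ℝ), IsOpen U ∧ Y ⊆ U ∧ 0 < a ∧ a < 1 ∧
        (∀ p : ℕ, 2 / t < p → ∀ x ∈ U, partialBergman h g Y t p x ≤ a ^ p) ∧
        IsBigOInfty (partialBergman h g Y t) U := by
  choose! U hUo hyU hU using fun y (hy : y ∈ Y) =>
    exists_partialBergman_le_half_pow g hY hh ht hy
  have hdecay : ∀ p : ℕ, 2 / t < p → ∀ x ∈ ⋃ y ∈ Y, U y,
      partialBergman h g Y t p x ≤ (1 / 2) ^ p := by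
    intro p hp x hx
    obtain ⟨y, hy, hxy⟩ := mem_iUnion₂.1 hx
    exact hU y hy p hp x hxy
  refine ⟨⋃ y ∈ Y, U y, 1 / 2, isOpen_biUnion hUo, fun y hy => mem_biUnion hy (hyU y hy),
    by norm_num, by norm_num, hdecay, ?_⟩
  choose B hB0 hB using fun p => exists_tensorNormSq_le (L := L) g hh Y ⌊t * (p : ℕ)⌋₊ p
  refine isBigOInfty_of_le_pow (N := 2 / t) (fun p x _ => partialBergman_nonneg g h t x)
    (fun K _ _ => ⟨∑ p ∈ Finset.range (⌊2 / t⌋₊ + 1), B p, fun p _ hp x _ => ?_⟩)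
    (fun K hK _ => ⟨1 / 2, by norm_num, by norm_num, fun p hp x hx => hdecay p hp x (hK hx)⟩)
  refine (partialBergman_le g hh (hB0 p) fun S hS => hB p S hS x).trans ?_
  refine Finset.single_le_sum (f := B) (fun i _ => hB0 i) (Finset.mem_range.2 ?_)
  exact Nat.lt_succ_of_le (Nat.le_floor hp)

end Decay

/-! ### The canonical section of the hypersurface -/

section Canonical

variable {n : ℕ} {X : Type*} [TopologicalSpace X] [ChartedSpace (Fin n → ℂ) X] {Y : Set X}
  {O : X → Type*} [TopologicalSpace (Bundle.TotalSpace ℂ O)] [∀ x, AddCommGroup (O x)]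
  [∀ x, Module ℂ (O x)] [∀ x, TopologicalSpace (O x)] [FiberBundle ℂ O] [VectorBundle ℂ ℂ O]
  [ContMDiffVectorBundle ω ℂ O 𝓘(ℂ, Fin n → ℂ)]

/-- In a local frame, the norm of a canonical section is `|f| e^{-w}` for a defining function `f`
of `Y` and a continuous function `w`. -/
theorem IsCanonicalSection.exists_norm_eq {s : ∀ x, O x} (hs : IsCanonicalSection n Y s)
    {k : LineMetric O} (hk : k.IsSmooth n) (x : X) :
    ∃ V : Set X, IsOpen V ∧ x ∈ V ∧ ∃ (f : X → ℂ) (w : X → ℝ), IsDefiningFunctionOn n Y V f ∧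
      ContinuousOn w V ∧ ∀ y ∈ V, k.norm y (s y) = ‖f y‖ * Real.exp (-w y) := by
  obtain ⟨e, he⟩ := exists_isFrameOn_baseSet (n := n) (L := O) x
  have hV := (trivializationAt ℂ O x).open_baseSet
  obtain ⟨f, hf, hfs⟩ := hs _ hV e he
  refine ⟨_, hV, FiberBundle.mem_baseSet_trivializationAt' x, f, k.weight e, hf,
    (hk _ hV e he).continuousOn, fun y hy => ?_⟩
  rw [hfs y hy, k.norm_smul, k.norm_eq_exp_weight (he.ne_zero y hy)]

theorem IsCanonicalSection.continuous_norm {s : ∀ x, O x} (hs : IsCanonicalSection n Y s)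
    {k : LineMetric O} (hk : k.IsSmooth n) : Continuous fun x => k.norm x (s x) := by
  refine continuous_iff_continuousAt.2 fun x => ?_
  obtain ⟨V, hV, hxV, f, w, hf, hw, heq⟩ := hs.exists_norm_eq hk x
  have h1 : ContinuousOn (fun y => ‖f y‖ * Real.exp (-w y)) V :=
    hf.holomorphic.continuousOn.norm.mul (Real.continuous_exp.comp_continuousOn hw.neg)
  exact (h1.congr heq).continuousAt (hV.mem_nhds hxV)

theorem IsCanonicalSection.norm_eq_zero_iff {s : ∀ x, O x} (hs : IsCanonicalSection n Y s)
    {k : LineMetric O} (hk : k.IsSmooth n) (x : X) : k.norm x (s x) = 0 ↔ x ∈ Y := by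
  obtain ⟨V, hV, hxV, f, w, hf, hw, heq⟩ := hs.exists_norm_eq hk x
  rw [heq x hxV, ← hf.zero_iff x hxV, mul_eq_zero, or_iff_left (Real.exp_pos _).ne', norm_eq_zero]

/-- On compact subsets of an adapted chart, `|z₀|` is bounded by a multiple of the norm of the
canonical section. -/
theorem IsCanonicalSection.exists_norm_coord_le [NeZero n] {s : ∀ x, O x}
    (hs : IsCanonicalSection n Y s) {k : LineMetric O} (hk : k.IsSmooth n)
    {φ : OpenPartialHomeomorph X (Fin n → ℂ)}
    (hφ : φ ∈ IsManifold.maximalAtlas 𝓘(ℂ, Fin n → ℂ) ω X)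
    (hφY : ∀ x ∈ φ.source, x ∈ Y ↔ φ x 0 = 0) {K : Set X} (hK : IsCompact K)
    (hKφ : K ⊆ φ.source) : ∃ B : ℝ, 0 ≤ B ∧ ∀ y ∈ K, ‖φ y 0‖ ≤ B * k.norm y (s y) := by
  refine hK.induction_on (p := fun K => ∃ B : ℝ, 0 ≤ B ∧ ∀ y ∈ K, ‖φ y 0‖ ≤ B * k.norm y (s y))
    ⟨0, le_rfl, by simp⟩ ?_ ?_ ?_
  · rintro S T hST ⟨B, hB0, hB⟩
    exact ⟨B, hB0, fun y hy => hB y (hST hy)⟩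
  · rintro S T ⟨B, hB0, hB⟩ ⟨D, hD0, hD⟩
    refine ⟨max B D, le_max_of_le_left hB0, fun y hy => ?_⟩
    have hN := k.norm_nonneg y (s y)
    rcases hy with hy | hy
    · exact (hB y hy).trans (mul_le_mul_of_nonneg_right (le_max_left _ _) hN)
    · exact (hD y hy).trans (mul_le_mul_of_nonneg_right (le_max_right _ _) hN)
  · intro x hxK
    suffices H : ∃ B : ℝ, 0 ≤ B ∧ ∀ᶠ y in 𝓝 x, ‖φ y 0‖ ≤ B * k.norm y (s y) by
      obtain ⟨B, hB0, hB⟩ := H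
      exact ⟨_, mem_nhdsWithin_of_mem_nhds hB, B, hB0, fun y hy => hy⟩
    have hx := hKφ hxK
    by_cases hxY : x ∈ Y
    · obtain ⟨V, hV, hxV, f, w, hf, hw, heq⟩ := hs.exists_norm_eq hk x
      obtain ⟨B, hB0, hB⟩ := hf.exists_norm_coord_le hV hφ hφY hx hxV hxY
      have hwx : ∀ᶠ y in 𝓝 x, w y < w x + 1 :=
        (hw.continuousAt (hV.mem_nhds hxV)).eventually_lt_const (lt_add_one _)
      refine ⟨B * Real.exp (w x + 1), by positivity, ?_⟩
      filter_upwards [hB, hwx, hV.mem_nhds hxV] with y hy hwy hyV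
      rw [heq y hyV]
      have h1 : 1 ≤ Real.exp (w x + 1) * Real.exp (-w y) := by
        rw [← Real.exp_add]; exact Real.one_le_exp (by linarith)
      calc ‖φ y 0‖ ≤ B * ‖f y‖ := hy
        _ ≤ B * ‖f y‖ * (Real.exp (w x + 1) * Real.exp (-w y)) :=
            le_mul_of_one_le_right (by positivity) h1
        _ = _ := by ring
    · have hr : 0 < k.norm x (s x) :=
        (k.norm_nonneg _ _).lt_of_ne fun h => hxY ((hs.norm_eq_zero_iff hk x).1 h.symm)
      have h1 : ∀ᶠ y in 𝓝 x, k.norm x (s x) / 2 < k.norm y (s y) :=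
        (hs.continuous_norm hk).continuousAt.eventually_const_lt (half_lt_self hr)
      have h2 : ∀ᶠ y in 𝓝 x, ‖φ y 0‖ < ‖φ x 0‖ + 1 :=
        (((continuous_apply 0).continuousAt).comp (φ.continuousAt hx)).norm.eventually_lt_const
          (lt_add_one _)
      refine ⟨(‖φ x 0‖ + 1) * (2 / k.norm x (s x)), by positivity, ?_⟩
      filter_upwards [h1, h2] with y h1 h2
      refine h2.le.trans ?_
      rw [mul_assoc]
      refine le_mul_of_one_le_right (by positivity) ?_
      rw [div_mul_eq_mul_div, one_le_div hr]
      linarith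

end Canonical

/-! ### Uniform estimates on a cover by adapted polydisks -/

section Cover

variable {n : ℕ} [NeZero n] {X : Type*} [TopologicalSpace X] [ChartedSpace (Fin n → ℂ) X]
  {Y : Set X}

theorem AdaptedCover.isCompact_polydisk (𝒲 : AdaptedCover n Y) (j : Fin 𝒲.N) {r : ℝ}
    (hr : r ≤ 2) : IsCompact (𝒲.polydisk j r) :=
  (isCompact_closedBall _ _).image_of_continuousOn ((𝒲.chart j).continuousOn_symm.mono
    ((closedBall_subset_closedBall hr).trans (𝒲.polydisk_subset j)))

theorem AdaptedCover.polydisk_subset_source (𝒲 : AdaptedCover n Y) (j : Fin 𝒲.N) {r : ℝ}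
    (hr : r ≤ 2) : 𝒲.polydisk j r ⊆ (𝒲.chart j).source := by
  rintro _ ⟨z, hz, rfl⟩
  exact (𝒲.chart j).map_target (𝒲.polydisk_subset j (closedBall_subset_closedBall hr hz))

variable {L : X → Type*} [TopologicalSpace (Bundle.TotalSpace ℂ L)] [∀ x, AddCommGroup (L x)]
  [∀ x, Module ℂ (L x)] [∀ x, TopologicalSpace (L x)] [FiberBundle ℂ L] [VectorBundle ℂ ℂ L]

theorem LineMetric.HasLocallyBoundedWeights.bddAbove_supNorm {h : LineMetric L}
    (hh : h.HasLocallyBoundedWeights n) (𝒲 : AdaptedCover n Y) {e : Fin 𝒲.N → ∀ x, L x}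
    (he : ∀ j, IsFrameOn n L (𝒲.chart j).source (e j)) :
    BddAbove ({1} ∪ ⋃ j, (fun x => |h.weight (e j) x|) '' 𝒲.polydisk j 2) := by
  refine bddAbove_singleton.union ?_
  rw [← biUnion_univ]
  refine (finite_univ.bddAbove_biUnion).2 fun j _ => ?_
  obtain ⟨C, hC⟩ := hh.exists_abs_weight_le (𝒲.chart j).open_source (he j)
    (𝒲.isCompact_polydisk j le_rfl) (𝒲.polydisk_subset_source j le_rfl)
  exact ⟨C, by rintro _ ⟨x, hx, rfl⟩; exact hC x hx⟩

theorem LineMetric.HasLocallyBoundedWeights.one_le_supNorm {h : LineMetric L}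
    (hh : h.HasLocallyBoundedWeights n) (𝒲 : AdaptedCover n Y) {e : Fin 𝒲.N → ∀ x, L x}
    (he : ∀ j, IsFrameOn n L (𝒲.chart j).source (e j)) : 1 ≤ h.supNorm 𝒲 e :=
  le_csSup (hh.bddAbove_supNorm 𝒲 he) (Or.inl rfl)

theorem LineMetric.HasLocallyBoundedWeights.abs_weight_le_supNorm {h : LineMetric L}
    (hh : h.HasLocallyBoundedWeights n) (𝒲 : AdaptedCover n Y) {e : Fin 𝒲.N → ∀ x, L x}
    (he : ∀ j, IsFrameOn n L (𝒲.chart j).source (e j)) (j : Fin 𝒲.N) {x : X}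
    (hx : x ∈ 𝒲.polydisk j 2) : |h.weight (e j) x| ≤ h.supNorm 𝒲 e :=
  le_csSup (hh.bddAbove_supNorm 𝒲 he) (Or.inr (mem_iUnion.2 ⟨j, mem_image_of_mem _ hx⟩))

/-- The set on which the decay estimate holds is a neighbourhood of `Y` as soon as the polydisks
cover one, because the canonical section vanishes on `Y`. -/
theorem decaySet_mem_nhdsSet {𝒲 : AdaptedCover n Y} {r : X → ℝ} (hr : Continuous r)
    (hrY : ∀ y ∈ Y, r y = 0) {A t M : ℝ} (ht : 0 < t) (hW : 𝒲.W ∈ 𝓝ˢ Y) :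
    decaySet 𝒲 r A t M ∈ 𝓝ˢ Y := by
  rw [mem_nhdsSet_iff_forall] at hW ⊢
  intro y hy
  have h1 : Continuous fun x => (A * r x) ^ t * Real.exp (4 * M) :=
    ((continuous_const.mul hr).rpow_const fun _ => Or.inr ht.le).mul continuous_const
  have h2 : (A * r y) ^ t * Real.exp (4 * M) < 1 := by
    rw [hrY y hy, mul_zero, Real.zero_rpow ht.ne', zero_mul]; exact one_pos
  filter_upwards [hW y hy, h1.continuousAt.eventually_lt_const h2] with x hx hx' using ⟨hx, hx'⟩

end Cover

section Estimates

variable {n : ℕ} [NeZero n] {X : Type*} [TopologicalSpace X] [ChartedSpace (Fin n → ℂ) X]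
  [IsManifold 𝓘(ℂ, Fin n → ℂ) ω X] {Y : Set X} [CompactSpace X] [MeasurableSpace X] [BorelSpace X]

/-- The constant `A` of the estimates: it dominates the constants of the local `L²` estimates in
the finitely many charts, and `|z₀| ≤ B |s|` is absorbed in `A |s|`. -/
theorem exists_uniform_section_bound (g : HermitianMetric n X)
    {O : X → Type*} [TopologicalSpace (Bundle.TotalSpace ℂ O)] [∀ x, AddCommGroup (O x)]
    [∀ x, Module ℂ (O x)] [∀ x, TopologicalSpace (O x)] [FiberBundle ℂ O] [VectorBundle ℂ ℂ O]
    [ContMDiffVectorBundle ω ℂ O 𝓘(ℂ, Fin n → ℂ)] {s : ∀ x, O x} (hs : IsCanonicalSection n Y s)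
    {k : LineMetric O} (hk : k.IsSmooth n) (𝒲 : AdaptedCover n Y) :
    ∃ A : ℝ, 1 ≤ A ∧ ∀ (L : X → Type*) [TopologicalSpace (Bundle.TotalSpace ℂ L)]
      [∀ x, AddCommGroup (L x)] [∀ x, Module ℂ (L x)] [∀ x, TopologicalSpace (L x)]
      [FiberBundle ℂ L] [VectorBundle ℂ ℂ L] [ContMDiffVectorBundle ω ℂ L 𝓘(ℂ, Fin n → ℂ)]
      (h : LineMetric L), h.HasLocallyBoundedWeights n →
      ∀ e : Fin 𝒲.N → ∀ x, L x, (∀ j, IsFrameOn n L (𝒲.chart j).source (e j)) →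
      ∀ m p : ℕ, ∀ x ∈ 𝒲.W, ∀ S ∈ sectionsVanishing L n Y m p,
        (1 ≤ m → h.tensorNormSq p x (S x) ≤ (A * k.norm x (s x)) ^ (2 * m) *
          Real.exp (4 * p * h.supNorm 𝒲 e) * h.sectionNormSq g p S) ∧
        (m = 0 → h.tensorNormSq p x (S x) ≤
          A * Real.exp (4 * p * h.supNorm 𝒲 e) * h.sectionNormSq g p S) := by
  choose C hC1 hC using fun j => g.exists_enorm_sq_le_setLIntegral (𝒲.chart_mem j)
    (𝒲.polydisk_subset j)
  choose B hB0 hB using fun j => hs.exists_norm_coord_le hk (𝒲.chart_mem j) (𝒲.mem_iff j)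
    (𝒲.isCompact_polydisk j (r := 1) (by norm_num))
    (𝒲.polydisk_subset_source j (by norm_num))
  have hCB : ∀ j, 0 ≤ C j * (1 + B j) := fun j =>
    mul_nonneg (zero_le_one.trans (hC1 j)) (by linarith [hB0 j])
  set A := 1 + ∑ j, C j * (1 + B j) with hA
  have hAj : ∀ j, C j * (1 + B j) ≤ A := fun j => by
    have := Finset.single_le_sum (f := fun j => C j * (1 + B j)) (fun i _ => hCB i)
      (Finset.mem_univ j)
    linarith
  refine ⟨A, by have := Finset.sum_nonneg fun j (_ : j ∈ Finset.univ) => hCB j; linarith, ?_⟩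
  intro L _ _ _ _ _ _ _ h hh e he m p x hx S hS
  obtain ⟨j, hj⟩ := mem_iUnion.1 hx
  have hC0 : 0 ≤ C j := zero_le_one.trans (hC1 j)
  have hN := sectionNormSq_nonneg g hh hS
  have hr := k.norm_nonneg x (s x)
  have key := tensorNormSq_le_of_adapted g hh (𝒲.chart_mem j) (𝒲.polydisk_subset j) (𝒲.mem_iff j)
    hC0 (hC j) (he j) (fun y hy => hh.abs_weight_le_supNorm 𝒲 he j hy) hS hj
  refine ⟨fun hm => key.trans ?_, fun hm => key.trans ?_⟩
  · refine mul_le_mul_of_nonneg_right (mul_le_mul_of_nonneg_right ?_ (Real.exp_pos _).le) hN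
    calc C j * ‖𝒲.chart j x 0‖ ^ (2 * m)
        ≤ C j ^ (2 * m) * ((1 + B j) * k.norm x (s x)) ^ (2 * m) := by
          refine mul_le_mul (le_self_pow₀ (hC1 j) (by omega))
            (pow_le_pow_left₀ (norm_nonneg _) ?_ _) (by positivity) (by positivity)
          refine (hB j x hj).trans (mul_le_mul_of_nonneg_right ?_ hr)
          linarith
      _ = (C j * (1 + B j) * k.norm x (s x)) ^ (2 * m) := by rw [← mul_pow, mul_assoc]
      _ ≤ (A * k.norm x (s x)) ^ (2 * m) :=
          pow_le_pow_left₀ (mul_nonneg (hCB j) hr) (mul_le_mul_of_nonneg_right (hAj j) hr) _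
  · refine mul_le_mul_of_nonneg_right (mul_le_mul_of_nonneg_right ?_ (Real.exp_pos _).le) hN
    rw [hm, mul_zero, pow_zero, mul_one]
    refine le_trans ?_ (hAj j)
    exact le_mul_of_one_le_right hC0 (by linarith [hB0 j])

end Estimates

theorem theorem1p1 {n : ℕ} [NeZero n]
    {X : Type*} [TopologicalSpace X] [T2Space X] [CompactSpace X]
    [ChartedSpace (Fin n → ℂ) X] [IsManifold 𝓘(ℂ, Fin n → ℂ) ω X]
    [MeasurableSpace X] [BorelSpace X]
    (g : HermitianMetric n X) (Y : Set X) (hY : IsSmoothHypersurface n Y) :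
    -- well-definedness of the partial Bergman kernel, and its exponential decay near `Y`
    (∀ t : ℝ, 0 < t → ∀ (L : X → Type*) [TopologicalSpace (Bundle.TotalSpace ℂ L)]
      [∀ x, AddCommGroup (L x)] [∀ x, Module ℂ (L x)] [∀ x, TopologicalSpace (L x)]
      [FiberBundle ℂ L] [VectorBundle ℂ ℂ L]
      [ContMDiffVectorBundle ω ℂ L 𝓘(ℂ, Fin n → ℂ)]
      (h : LineMetric L), h.HasLocallyBoundedWeights n →
      (∀ p : ℕ, FiniteDimensional ℂ (partialSections n L Y t p) ∧
        (∃ b : Module.Basis (Fin (Module.finrank ℂ (partialSections n L Y t p))) ℂ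
          (partialSections n L Y t p), IsOrthonormalSectionBasis h g Y t p b) ∧
        ∀ (d : ℕ) (b : Module.Basis (Fin d) ℂ (partialSections n L Y t p)),
          IsOrthonormalSectionBasis h g Y t p b →
          ∀ x, partialBergman h g Y t p x =
            ∑ i, h.tensorNormSq p x ((b i : ∀ x, ⨂[ℂ]^p (L x)) x)) ∧
      ∃ (U : Set X) (a : ℝ), IsOpen U ∧ Y ⊆ U ∧ 0 < a ∧ a < 1 ∧
        (∀ p : ℕ, 2 / t < p → ∀ x ∈ U, partialBergman h g Y t p x ≤ a ^ p) ∧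
        IsBigOInfty (partialBergman h g Y t) U) ∧
    -- the precise estimates: `O` with its section `s` is the line bundle of the divisor `Y`, with a
    -- smooth metric `k` such that `e^ρ = |s|_k < 1`
    (∀ (O : X → Type*) [TopologicalSpace (Bundle.TotalSpace ℂ O)]
      [∀ x, AddCommGroup (O x)] [∀ x, Module ℂ (O x)] [∀ x, TopologicalSpace (O x)]
      [FiberBundle ℂ O] [VectorBundle ℂ ℂ O]
      [ContMDiffVectorBundle ω ℂ O 𝓘(ℂ, Fin n → ℂ)]
      (s : ∀ x, O x), IsCanonicalSection n Y s →
      ∀ k : LineMetric O, k.IsSmooth n → (∀ x, k.norm x (s x) < 1) →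
      ∀ 𝒲 : AdaptedCover n Y,
      ∃ A : ℝ, 1 ≤ A ∧
      ∀ t : ℝ, 0 < t → ∀ (L : X → Type*) [TopologicalSpace (Bundle.TotalSpace ℂ L)]
        [∀ x, AddCommGroup (L x)] [∀ x, Module ℂ (L x)] [∀ x, TopologicalSpace (L x)]
        [FiberBundle ℂ L] [VectorBundle ℂ ℂ L]
        [ContMDiffVectorBundle ω ℂ L 𝓘(ℂ, Fin n → ℂ)]
        (h : LineMetric L), h.HasLocallyBoundedWeights n →
        ∀ e : Fin 𝒲.N → ∀ x, L x, (∀ j, IsFrameOn n L (𝒲.chart j).source (e j)) →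
        (∀ p : ℕ, 1 ≤ p → ∀ x ∈ 𝒲.W,
          (1 ≤ t * p →
            (∀ S ∈ partialSections n L Y t p,
              h.tensorNormSq p x (S x) ≤ (A * k.norm x (s x)) ^ (2 * ⌊t * p⌋₊) *
                Real.exp (4 * p * h.supNorm 𝒲 e) * h.sectionNormSq g p S) ∧
            partialBergman h g Y t p x ≤ (A * k.norm x (s x)) ^ (2 * ⌊t * p⌋₊) *
              Real.exp (4 * p * h.supNorm 𝒲 e)) ∧
          (t * p < 1 →
            (∀ S ∈ partialSections n L Y t p,
              h.tensorNormSq p x (S x) ≤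
                A * Real.exp (4 * p * h.supNorm 𝒲 e) * h.sectionNormSq g p S) ∧
            partialBergman h g Y t p x ≤ A * Real.exp (4 * p * h.supNorm 𝒲 e))) ∧
        (∀ p : ℕ, 2 / t < p → ∀ x ∈ decaySet 𝒲 (fun x => k.norm x (s x)) A t (h.supNorm 𝒲 e),
          partialBergman h g Y t p x ≤
            ((A * k.norm x (s x)) ^ t * Real.exp (4 * h.supNorm 𝒲 e)) ^ p) ∧
        IsBigOInfty (partialBergman h g Y t)
          (decaySet 𝒲 (fun x => k.norm x (s x)) A t (h.supNorm 𝒲 e)) ∧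
        (𝒲.W ∈ 𝓝ˢ Y →
          decaySet 𝒲 (fun x => k.norm x (s x)) A t (h.supNorm 𝒲 e) ∈ 𝓝ˢ Y)) := by
  refine ⟨?_, ?_⟩
  · intro t ht L _ _ _ _ _ _ _ h hh
    exact ⟨fun p => ⟨finiteDimensional_sectionsVanishing g hh Y _ p,
      exists_isOrthonormalSectionBasis g hh Y t p,
      fun d b hb x => partialBergman_eq_sum g hh hb x⟩,
      exists_isOpen_partialBergman_decay g hY hh ht⟩
  · intro O _ _ _ _ _ _ _ s hs k hk _ 𝒲
    obtain ⟨A, hA1, hA⟩ := exists_uniform_section_bound g hs hk 𝒲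
    refine ⟨A, hA1, ?_⟩
    intro t ht L _ _ _ _ _ _ _ h hh e he
    have hA0 : 0 ≤ A := zero_le_one.trans hA1
    have hr0 : ∀ x, 0 ≤ A * k.norm x (s x) := fun x => mul_nonneg hA0 (k.norm_nonneg x _)
    have hM1 := hh.one_le_supNorm 𝒲 he
    set M := h.supNorm 𝒲 e with hM
    have hcont : Continuous fun x => (A * k.norm x (s x)) ^ t * Real.exp (4 * M) :=
      ((continuous_const.mul (hs.continuous_norm hk)).rpow_const
        fun _ => Or.inr ht.le).mul continuous_const
    have hest : ∀ p : ℕ, 1 ≤ p → ∀ x ∈ 𝒲.W,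
        (1 ≤ t * p →
          (∀ S ∈ partialSections n L Y t p,
            h.tensorNormSq p x (S x) ≤ (A * k.norm x (s x)) ^ (2 * ⌊t * p⌋₊) *
              Real.exp (4 * p * M) * h.sectionNormSq g p S) ∧
          partialBergman h g Y t p x ≤ (A * k.norm x (s x)) ^ (2 * ⌊t * p⌋₊) *
            Real.exp (4 * p * M)) ∧
        (t * p < 1 →
          (∀ S ∈ partialSections n L Y t p,
            h.tensorNormSq p x (S x) ≤
              A * Real.exp (4 * p * M) * h.sectionNormSq g p S) ∧
          partialBergman h g Y t p x ≤ A * Real.exp (4 * p * M)) := by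
      intro p _ x hx
      refine ⟨fun htp => ?_, fun htp => ?_⟩
      · have h1 : ∀ S ∈ partialSections n L Y t p, _ := fun S hS =>
          (hA L h hh e he ⌊t * p⌋₊ p x hx S hS).1 (Nat.le_floor (by exact_mod_cast htp))
        exact ⟨h1, partialBergman_le g hh
          (mul_nonneg (pow_nonneg (hr0 x) _) (Real.exp_pos _).le) h1⟩
      · have h1 : ∀ S ∈ partialSections n L Y t p, _ := fun S hS =>
          (hA L h hh e he ⌊t * p⌋₊ p x hx S hS).2 (Nat.floor_eq_zero.2 htp)
        exact ⟨h1, partialBergman_le g hh (mul_nonneg hA0 (Real.exp_pos _).le) h1⟩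
    have hlt1 : ∀ x ∈ decaySet 𝒲 (fun x => k.norm x (s x)) A t M, A * k.norm x (s x) < 1 := by
      rintro x ⟨-, hx⟩
      by_contra! hge
      have h1 := Real.one_le_rpow hge ht.le
      have h2 : 1 ≤ Real.exp (4 * M) := Real.one_le_exp (by linarith)
      exact absurd hx (not_lt.2 (one_le_mul_of_one_le_of_one_le h1 h2))
    have hdecay : ∀ p : ℕ, 2 / t < p → ∀ x ∈ decaySet 𝒲 (fun x => k.norm x (s x)) A t M,
        partialBergman h g Y t p x ≤ ((A * k.norm x (s x)) ^ t * Real.exp (4 * M)) ^ p := by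
      intro p hp x hx
      have hp0 : (0 : ℝ) < p := (div_pos two_pos ht).trans hp
      have htp : 2 < t * p := by rwa [div_lt_iff₀' ht] at hp
      exact (((hest p (by exact_mod_cast hp0) x hx.1).1 (by linarith)).2).trans
        (pow_floor_mul_exp_le (hr0 x) (hlt1 x hx).le ht hp)
    refine ⟨hest, hdecay, ?_, decaySet_mem_nhdsSet (hs.continuous_norm hk)
      (fun y hy => (hs.norm_eq_zero_iff hk y).2 hy) ht⟩
    refine isBigOInfty_of_le_pow (N := 2 / t) (fun p x _ => partialBergman_nonneg g h t x) ?_ ?_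
    · -- on the decay set, both estimates are at most `A * exp (4 * p * M)`
      intro K hKM _
      refine ⟨A * Real.exp (4 * (2 / t) * M), fun p hp hpN x hx => ?_⟩
      have hx' := hKM hx
      have h1 : partialBergman h g Y t p x ≤ A * Real.exp (4 * p * M) := by
        rcases le_or_gt 1 (t * p) with htp | htp
        · refine ((hest p hp x hx'.1).1 htp).2.trans
            (mul_le_mul_of_nonneg_right ?_ (Real.exp_pos _).le)
          exact (pow_le_one₀ (hr0 x) (hlt1 x hx').le).trans hA1
        · exact ((hest p hp x hx'.1).2 htp).2
      refine h1.trans (mul_le_mul_of_nonneg_left (Real.exp_le_exp.2 ?_) hA0)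
      have : 0 ≤ M := by linarith
      gcongr
    · -- the base of the exponential bound is continuous, hence bounded away from `1` on `K`
      intro K hKM hK
      rcases K.eq_empty_or_nonempty with rfl | hne
      · exact ⟨0, le_rfl, one_pos, by simp⟩
      obtain ⟨x₀, hx₀, hmax⟩ := hK.exists_isMaxOn hne hcont.continuousOn
      have hbase : ∀ x, 0 ≤ (A * k.norm x (s x)) ^ t * Real.exp (4 * M) := fun x =>
        mul_nonneg (Real.rpow_nonneg (hr0 x) t) (Real.exp_pos _).le
      exact ⟨_, hbase x₀, (hKM hx₀).2, fun p hp x hx =>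
        (hdecay p hp x (hKM hx)).trans (pow_le_pow_left₀ (hbase x) (hmax hx) p)⟩
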